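/- **The market.** A mixed economy $\mathcal M$ has a finite set $A$ of agents, a finite non-empty set $C$ of (divisible) conventional goods and a finite set $J$ of digital categories. Each category $j\in J$ starts with a finite non-empty set $S_j$ of songs; each song of $S_j$ is owned by one agent. A bundle or a production point is a vector in $\mathbb R_+^{C\cup J}$ (amounts of conventional goods, numbers of songs per category). - Each agent $i$ has a compact convex set $P_i\subset\mathbb R_+^{C\cup J}$ of feasible production points, and each conventional good can be produced in a positive amount by at least one agent. - Each agent $i$ has a coarse utility function $f_i:\mathbb R_+^{C\cup J}\to\mathbb R_+$ that is continuous, quasi-concave and non-satiated in each good: for every bundle $z$ and every $a\in C\cup J$ there is a bundle $z'$ with $z'_a>z_a$, $z'_b=z_b$ for $b\ne a$, and $f_i(z')>f_i(z)$. - For each category $j$, agent $i$ has a strict total order on the sellers $S_j\cup A$ (the initial songs, and the agents as producers of new songs). For a production $y=(y_i)_{i\in A}$ put $y_{kj}=1$ for $k\in S_j$, and $Y_j=\sum_{k\in S_j\cup A}y_{kj}$. If agent $i$ takes $q$ songs of category $j$ in the order of her ranking, she gets $\min\{y_{kj},\max(0,\,q-\sum_{k'\succ_{ij}k}y_{k'j})\}$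 from each seller $k\in S_j\cup A$. **Earnings.** Let $p$ be prices and let $x_{bjk}$ be what agent $b$ buys from seller $k$ of category $j$. Given $p$, $x$ and the productions of the other agents, agent $i$ earns from $y'\in P_i$ $$\sum_{c\in C}p_c\,y'_c+\sum_{j\in J}p_j\sum_{b\in A}\Big(\sum_{s\in S_j\text{ owned by }i}x_{bjs}+\min\Big\{y'_j,\ \max\Big(0,\ \sum_{k}x_{bjk}-\sum_{k\succ_{bj}i}y_{kj}\Big)\Big\}\Big):$$ the sales of her initial songs are those in the given allocation, and of the songs that she produces each agent $b$ buys as many as are left to buy after the sellers whom $b$ ranks above $i$. **Equilibrium with transfers.** Let $w=(w_i)_{i\in A}$, $w_i\ge0$. An equilibrium with wealth transfer function $w$ consists of prices $p\ge0$, a coarse allocation $z=(z_i)$, $z_i\in\mathbb R_+^{C\cup J}$, a detailed allocation $x$ and a production $y$ such that 1. $y_i\in P_i$, and $y_i$ maximizes agent $i$'s earnings over $P_i$, given $p$, $x$ and the productions of the other agents; moreover $\sum_i w_i$ is the sum of all agents' earnings; 2. $p\cdot z_i=w_i$, and $z_i$ maximizes $f_i$ over $\{z'\in\mathbb R_+^{C\cup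 J}: p\cdot z'\le w_i\}$; and $x_{ij\cdot}$ arises by taking $z_{ij}$ songs of category $j$ in the order of $i$'s ranking; 3. $\sum_i z_{ic}=\sum_i y_{ic}$ for all $c\in C$; for every $j\in J$ with $p_j>0$ and every $k\in S_j\cup A$ there is an agent $i$ with $x_{ijk}=y_{kj}$ (everything offered is bought in full by some agent); and $z_{ij}\le Y_j$ for all $i,j$. **Theorem (Second Welfare Theorem).** Let $(u_i)_{i\in A}$ be utilities attained in the restriction of $\mathcal M$ to the conventional economy: there are $y_i\in P_i$ and $z_i\in\mathbb R_+^{C\cup J}$, all with zero digital coordinates, such that $\sum_i z_{ic}=\sum_i y_{ic}$ for all $c\in C$ and $u_i=f_i(z_i)$ for all $i$. Suppose that $u_i>0$ for at least one $i$. Then there are a wealth transfer function $w$, a number $\alpha\ge1$ and an equilibrium with wealth transfer function $w$ in which every agent $i\in A$ has utility $\alpha\,u_i$. -/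

import Mathlib

noncomputable section

/-- A mixed economy with a finite set `A` of agents, a finite set `C` of conventional goods and a
finite set `J` of digital categories; `S j` is the set of songs initially present in category `j`.
Bundles and production points are vectors indexed by `C ⊕ J`. The sellers in category `j` are the
elements of `S j ⊕ A`: the initial songs, and the agents as producers of new songs. -/
structure MixedMarket (A C J : Type*) (S : J → Type*) where
  /-- the feasible production points of each agent -/
  production : A → Set (C ⊕ J → ℝ)
  production_nonneg : ∀ i, ∀ y ∈ production i, 0 ≤ y
  production_compact : ∀ i, IsCompact (production i)
  production_convex : ∀ i, Convex ℝ (production i)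
  /-- every conventional good can be produced in a positive amount (by at least one agent) -/
  producible : ∀ c : C, ∃ i, ∃ y ∈ production i, 0 < y (Sum.inl c)
  /-- the coarse utility functions; only their values on the nonnegative orthant matter -/
  utility : A → (C ⊕ J → ℝ) → ℝ
  utility_nonneg : ∀ i z, 0 ≤ z → 0 ≤ utility i z
  utility_continuous : ∀ i, ContinuousOn (utility i) {z | 0 ≤ z}
  utility_quasiconcave : ∀ i, QuasiconcaveOn ℝ {z | 0 ≤ z} (utility i)
  /-- non-satiation in each good: from any bundle, some larger amount of the good `a` alone, all
  other amounts unchanged, is strictly better -/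
  utility_nonsatiated : ∀ i z, 0 ≤ z → ∀ a : C ⊕ J, ∃ z' : C ⊕ J → ℝ,
    (∀ b, b ≠ a → z' b = z b) ∧ z a < z' a ∧ utility i z < utility i z'
  /-- the owner of each initial song -/
  owner : ∀ j, S j → A
  /-- `prefers i j k k'`: agent `i` ranks the seller `k` of category `j` strictly above `k'` -/
  prefers : ∀ (_ : A) (j : J), S j ⊕ A → S j ⊕ A → Prop
  prefers_total : ∀ i j, IsStrictTotalOrder (S j ⊕ A) (prefers i j)

namespace MixedMarket

variable {A C J : Type*} {S : J → Type*} [Fintype A] [Fintype C] [Fintype J]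
  [∀ j, Fintype (S j)]

/-- The number of songs available from seller `k` in category `j` under the production `y`:
one for an initial song, the number of songs produced for an agent. -/
def available (y : A → C ⊕ J → ℝ) (j : J) : S j ⊕ A → ℝ
  | Sum.inl _ => 1
  | Sum.inr k => y k (Sum.inr j)

open Classical in
/-- The number of songs of category `j` available from the sellers that agent `i` ranks strictly
above `k`. -/
def availableAbove (M : MixedMarket A C J S) (y : A → C ⊕ J → ℝ) (i : A) (j : J)
    (k : S j ⊕ A) : ℝ :=
  ∑ k' : S j ⊕ A, if M.prefers i j k' k then available y j k' else 0

/-- What agent `i` gets from seller `k` if she takes `q` songs of category `j` in the order of her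
ranking. -/
def detailed (M : MixedMarket A C J S) (y : A → C ⊕ J → ℝ) (i : A) (j : J) (q : ℝ)
    (k : S j ⊕ A) : ℝ :=
  min (available y j k) (max 0 (q - M.availableAbove y i j k))

open Classical in
/-- The earnings of agent `i` from the production point `y'`, at prices `p`, given the digital
allocation `x` and the productions `y` of the other agents. Her initial songs earn what they sell
in `x`. Of the `y' j` songs of category `j` that she produces, the buyer `b`, who gets
`∑ k, x b j k` songs in that category, buys as many as are left to buy after the sellers whom `b`
ranks above `i`. (The value does not depend on `y i`, as `i` is not ranked above herself.) -/
def earnings (M : MixedMarket A C J S) (p : C ⊕ J → ℝ) (x : A → ∀ j : J, S j ⊕ A → ℝ)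
    (y : A → C ⊕ J → ℝ) (i : A) (y' : C ⊕ J → ℝ) : ℝ :=
  ∑ c : C, p (Sum.inl c) * y' (Sum.inl c) +
  ∑ j : J, p (Sum.inr j) * ∑ b : A,
    ((∑ s : S j, if M.owner j s = i then x b j (Sum.inl s) else 0) +
      min (y' (Sum.inr j))
        (max 0 (∑ k : S j ⊕ A, x b j k - M.availableAbove y b j (Sum.inr i))))

/-- Equilibrium with wealth transfer function `w`: prices `p`, coarse allocation `z`, its digital
part in detail `x` (`x i j k` is what `i` buys from seller `k` in category `j`), production `y`. -/
structure IsEquilibriumWithTransfers (M : MixedMarket A C J S) (w : A → ℝ) (p : C ⊕ J → ℝ)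
    (z : A → C ⊕ J → ℝ) (x : A → ∀ j : J, S j ⊕ A → ℝ) (y : A → C ⊕ J → ℝ) : Prop where
  price_nonneg : 0 ≤ p
  /-- `w` redistributes the total earnings -/
  transfer_nonneg : 0 ≤ w
  transfer_sum : ∑ i, w i = ∑ i, M.earnings p x y i (y i)
  /-- production is feasible and optimizes the earnings -/
  production_mem : ∀ i, y i ∈ M.production i
  production_optimal : ∀ i, ∀ y' ∈ M.production i,
    M.earnings p x y i y' ≤ M.earnings p x y i (y i)
  /-- each agent spends `w i` on an optimal coarse allocation ... -/
  allocation_nonneg : ∀ i, 0 ≤ z i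
  allocation_spends : ∀ i, ∑ a, p a * z i a = w i
  allocation_optimal : ∀ i, ∀ z' : C ⊕ J → ℝ, 0 ≤ z' → ∑ a, p a * z' a ≤ w i →
    M.utility i z' ≤ M.utility i (z i)
  /-- ... and gets her songs in the order of her ranking -/
  allocation_detailed : ∀ i j k, x i j k = M.detailed y i j (z i (Sum.inr j)) k
  /-- the markets of the conventional goods clear -/
  conventional_clears : ∀ c : C, ∑ i, z i (Sum.inl c) = ∑ i, y i (Sum.inl c)
  /-- in a category with positive price, everything that each seller offers is bought in full by
  some agent -/
  digital_sold : ∀ j : J, 0 < p (Sum.inr j) → ∀ k : S j ⊕ A, ∃ i, x i j k = available y j k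
  /-- nobody wants more songs of a category than it has -/
  digital_available : ∀ i (j : J), z i (Sum.inr j) ≤ ∑ k : S j ⊕ A, available y j k

/-- The utilities `u` are attained in the restriction to the conventional economy: each agent
picks a feasible production point without digital goods, and what is produced is allocated. -/
def AttainedConventionally (M : MixedMarket A C J S) (u : A → ℝ) : Prop :=
  ∃ y z : A → C ⊕ J → ℝ,
    (∀ i, y i ∈ M.production i) ∧ (∀ i (j : J), y i (Sum.inr j) = 0) ∧
    (∀ i, 0 ≤ z i) ∧ (∀ i (j : J), z i (Sum.inr j) = 0) ∧
    (∀ c : C, ∑ i, z i (Sum.inl c) = ∑ i, y i (Sum.inl c)) ∧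
    ∀ i, u i = M.utility i (z i)

end MixedMarket

end

/-! The utility profile is fixed up to a scale `α`, and prices, `α`, demands and productions are
found together. Each consumer takes a cheapest bundle of utility `α * u i` (compensated demand),
each producer maximizes profit, prices maximize the value `V` of excess demand, and `α` minimizes `α
* V` over an interval. Songs are non-rival, so excess demand in a digital category is the largest
individual demand minus the supply. A buyer's residual demand only caps a producer's sales, so
profit is concave in her own output; all responses are then convex, and Kakutani's theorem gives a
fixed point.

At the fixed point `V = 0`. If `V > 0`, then `α = 0`, so the consumption costs no more than the
conventional allocation, which is worth at most the optimal profits and hence at most what buyers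
pay for available goods (`value_conventional_le`); this forces `V ≤ 0` (`value_excess_nonpos`). If
`V < 0`, then `α` is maximal and promises some agent a utility that no bundle within the production
bound reaches. From `V = 0`, no excess is positive and every market with a positive price clears
(`exists_isQuasiEquilibrium`).

The box that truncates consumption is removed by compactness. Total expenditure is positive, so
non-satiation of an agent with positive budget makes all prices positive, and cheapest bundles
become utility-maximizing. The transfer `w i` is the cost of `z i`. If `α < 1`, this consumption
would cost less in total than the conventional allocation, against the same value comparison; so `α
≥ 1`.

Kakutani's theorem is derived from Brouwer's, and Brouwer's from Scarf's lemma, which rests on a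
parity count. -/

/-! ### Scarf's combinatorial lemma -/

section Scarf

variable {T I : Type*}

/-- A set `σ` of points is dominant for a set `C` of indices if no point exceeds, in each of the
rankings `r i` with `i ∈ C`, the least element of `σ`. -/
def DominantFor (r : I → T → ℕ) (σ : Finset T) (C : Finset I) : Prop :=
  ∀ y, ∃ i ∈ C, ∀ s ∈ σ, r i y ≤ r i s

theorem DominantFor.mono {r : I → T → ℕ} {σ τ : Finset T} {C D : Finset I}
    (h : DominantFor r σ C) (hτ : τ ⊆ σ) (hD : C ⊆ D) : DominantFor r τ D := by
  intro y
  obtain ⟨i, hi, hy⟩ := h y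
  exact ⟨i, hD hi, fun s hs => hy s (hτ hs)⟩

variable [DecidableEq T] [DecidableEq I]

/-- The pair `(σ, C)` arises from `(τ, D)` by dropping the index `a`, or by adding a point that
exceeds the least element of `τ` in all rankings of `D` other than that of `a`. -/
def IsExtensionAt (r : I → T → ℕ) (τ : Finset T) (D : Finset I) (a : I)
    (R : Finset T × Finset I) : Prop :=
  (R.1 = τ ∧ R.2 = D.erase a) ∨
    ∃ x, R.1 = insert x τ ∧ R.2 = D ∧ ∀ i ∈ D, i ≠ a → ∃ s ∈ τ, r i s < r i x

/-- A dominant pair with as many points as indices. -/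
def IsRoom (r : I → T → ℕ) (R : Finset T × Finset I) : Prop :=
  DominantFor r R.1 R.2 ∧ R.1.card = R.2.card

/-- This is the pivot step. Among the points above the least element of `τ` in all rankings of `D`
but that of `a`, only the one highest for `a` can be inserted without losing dominance; if there are
no such points, dropping `a` keeps dominance. The condition `hmin` keeps the inserted point outside
`τ`. -/
theorem existsUnique_isExtensionAt [Fintype T] {r : I → T → ℕ}
    (hr : ∀ i, Function.Injective (r i)) {τ : Finset T} {D : Finset I}
    (hdom : DominantFor r τ D) (hcard : D.card = τ.card + 1) {a : I} (ha : a ∈ D)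
    (hmin : ∀ t ∈ τ, ∃ k ∈ D, k ≠ a ∧ ∀ s ∈ τ, r k t ≤ r k s) :
    ∃! R, IsRoom r R ∧ IsExtensionAt r τ D a R := by
  classical
  by_cases hM : ∃ x, ∀ i ∈ D, i ≠ a → ∃ s ∈ τ, r i s < r i x
  · obtain ⟨x, hx, hmax⟩ := Finset.exists_max_image
      (Finset.univ.filter fun x => ∀ i ∈ D, i ≠ a → ∃ s ∈ τ, r i s < r i x) (r a)
      (by obtain ⟨x, hx⟩ := hM; exact ⟨x, by simpa using hx⟩)
    simp only [Finset.mem_filter, Finset.mem_univ, true_and] at hx hmax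
    have hxτ : x ∉ τ := by
      intro h
      obtain ⟨k, hk, hka, hks⟩ := hmin x h
      obtain ⟨s, hs, hlt⟩ := hx k hk hka
      exact absurd (hks s hs) (not_le.2 hlt)
    refine ⟨(insert x τ, D), ⟨⟨?_, ?_⟩, Or.inr ⟨x, rfl, rfl, hx⟩⟩, ?_⟩
    · intro y
      by_cases hy : ∀ i ∈ D, i ≠ a → ∃ s ∈ τ, r i s < r i y
      · refine ⟨a, ha, ?_⟩
        obtain ⟨i, hi, his⟩ := hdom y
        have hia : i = a := by
          by_contra hne
          obtain ⟨s, hs, hlt⟩ := hy i hi hne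
          exact absurd (his s hs) (not_le.2 hlt)
        subst hia
        intro s hs
        rcases Finset.mem_insert.1 hs with rfl | hs
        · exact hmax y hy
        · exact his s hs
      · push Not at hy
        obtain ⟨i, hi, hia, his⟩ := hy
        refine ⟨i, hi, fun s hs => ?_⟩
        rcases Finset.mem_insert.1 hs with rfl | hs
        · obtain ⟨s', hs', hlt⟩ := hx i hi hia
          exact (his s' hs').trans hlt.le
        · exact his s hs
    · simp [Finset.card_insert_of_notMem hxτ, hcard]
    · rintro ⟨σ, C⟩ ⟨⟨hd, -⟩, ⟨h1, h2⟩ | ⟨x', h1, h2, hx'⟩⟩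
      · simp only at h1 h2 hd
        subst h1 h2
        obtain ⟨i, hi, his⟩ := hd x
        obtain ⟨s, hs, hlt⟩ := hx i (Finset.mem_of_mem_erase hi) (Finset.ne_of_mem_erase hi)
        exact absurd (his s hs) (not_le.2 hlt)
      · simp only at h1 h2 hd
        subst h1 h2
        obtain ⟨i, hi, his⟩ := hd x
        have hia : i = a := by
          by_contra hne
          obtain ⟨s, hs, hlt⟩ := hx i hi hne
          exact absurd (his s (Finset.mem_insert_of_mem hs)) (not_le.2 hlt)
        subst hia
        have := le_antisymm (his x' (Finset.mem_insert_self _ _)) (hmax x' hx')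
        rw [hr i this]
  · push Not at hM
    refine ⟨(τ, D.erase a), ⟨⟨?_, ?_⟩, Or.inl ⟨rfl, rfl⟩⟩, ?_⟩
    · intro y
      obtain ⟨i, hi, hia, his⟩ := hM y
      exact ⟨i, Finset.mem_erase.2 ⟨hia, hi⟩, his⟩
    · simp [Finset.card_erase_of_mem ha, hcard]
    · rintro ⟨σ, C⟩ ⟨-, ⟨h1, h2⟩ | ⟨x', h1, h2, hx'⟩⟩
      · simp only at h1 h2
        rw [h1, h2]
      · obtain ⟨i, hi, hia, his⟩ := hM x'
        obtain ⟨s, hs, hlt⟩ := hx' i hi hia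
        exact absurd (his s hs) (not_le.2 hlt)

omit [DecidableEq T] in
/-- The least elements of `τ` in the rankings of `D` are distinct, but for one pair `a, b`. -/
theorem exists_pair_common_min {r : I → T → ℕ}
    (hr : ∀ i, Function.Injective (r i)) {τ : Finset T} {D : Finset I} (hτ : τ.Nonempty)
    (hdom : DominantFor r τ D) (hcard : D.card = τ.card + 1) :
    ∃ a ∈ D, ∃ b ∈ D, a ≠ b ∧
      (∃ t ∈ τ, (∀ s ∈ τ, r a t ≤ r a s) ∧ ∀ s ∈ τ, r b t ≤ r b s) ∧
      ∀ t ∈ τ, ∀ k ∈ D, ∀ l ∈ D, (∀ s ∈ τ, r k t ≤ r k s) → (∀ s ∈ τ, r l t ≤ r l s) →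
        k = l ∨ (k = a ∧ l = b) ∨ (k = b ∧ l = a) := by
  classical
  have h := fun t : T => hdom t
  choose φ hφD hφ using h
  have huniq : ∀ k, ∀ t ∈ τ, ∀ t' ∈ τ, (∀ s ∈ τ, r k t ≤ r k s) → (∀ s ∈ τ, r k t' ≤ r k s) →
      t = t' := fun k t ht t' ht' h1 h2 => hr k (le_antisymm (h1 t' ht') (h2 t ht))
  have hinj : Set.InjOn φ τ := by
    intro t ht t' ht' he
    exact huniq (φ t) t ht t' ht' (hφ t) (by rw [he]; exact hφ t')
  have hci : (τ.image φ).card = τ.card := Finset.card_image_of_injOn hinj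
  have hsub : τ.image φ ⊆ D := by
    intro k hk
    obtain ⟨t, -, rfl⟩ := Finset.mem_image.1 hk
    exact hφD t
  obtain ⟨a, ha, hDa⟩ : ∃ a, a ∉ τ.image φ ∧ insert a (τ.image φ) = D := by
    have : (D \ τ.image φ).card = 1 := by
      rw [Finset.card_sdiff_of_subset hsub]; omega
    obtain ⟨a, ha⟩ := Finset.card_eq_one.1 this
    have ha' : a ∈ D \ τ.image φ := by rw [ha]; simp
    refine ⟨a, (Finset.mem_sdiff.1 ha').2, ?_⟩
    rw [Finset.insert_eq, ← ha, Finset.sdiff_union_of_subset hsub]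
  obtain ⟨t₀, ht₀, hmin⟩ := Finset.exists_min_image τ (r a) hτ
  have haD : a ∈ D := hDa ▸ Finset.mem_insert_self _ _
  have key : ∀ t ∈ τ, ∀ k ∈ D, (∀ s ∈ τ, r k t ≤ r k s) → k = φ t ∨ (k = a ∧ t = t₀) := by
    intro t ht k hk hks
    rw [← hDa] at hk
    rcases Finset.mem_insert.1 hk with rfl | hk
    · exact Or.inr ⟨rfl, huniq k t ht t₀ ht₀ hks hmin⟩
    · obtain ⟨t', ht', rfl⟩ := Finset.mem_image.1 hk
      left
      rw [huniq _ t ht t' ht' hks (hφ t')]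
  refine ⟨a, haD, φ t₀, hφD t₀, ?_, ⟨t₀, ht₀, hmin, hφ t₀⟩, ?_⟩
  · intro h
    exact ha (h ▸ Finset.mem_image_of_mem φ ht₀)
  · intro t ht k hk l hl hks hls
    rcases key t ht k hk hks with h1 | ⟨h1, h1'⟩ <;> rcases key t ht l hl hls with h2 | ⟨h2, h2'⟩
    · left; rw [h1, h2]
    · right; right; exact ⟨by rw [h1, h2'], h2⟩
    · right; left; exact ⟨h1, by rw [h2, h1']⟩
    · left; rw [h1, h2]

/-- If a point `x` is added and becomes least for `k`, the former least element for `k` must be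
least for another index, by dominance; so `k` belongs to the exceptional pair `a, b`. If instead an
index is dropped, its least element is also least for a remaining index, so again it is `a` or `b`.
-/
theorem isExtensionAt_of_subset {r : I → T → ℕ}
    (hr : ∀ i, Function.Injective (r i)) {τ : Finset T} {D : Finset I}
    (hcard : D.card = τ.card + 1) {a b : I} 
    (hab : ∃ t ∈ τ, (∀ s ∈ τ, r a t ≤ r a s) ∧ ∀ s ∈ τ, r b t ≤ r b s)
    (hpair : ∀ t ∈ τ, ∀ k ∈ D, ∀ l ∈ D, (∀ s ∈ τ, r k t ≤ r k s) → (∀ s ∈ τ, r l t ≤ r l s) →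
        k = l ∨ (k = a ∧ l = b) ∨ (k = b ∧ l = a))
    (hτ : τ.Nonempty) {R : Finset T × Finset I} (hR : IsRoom r R) (h1 : τ ⊆ R.1) (h2 : R.2 ⊆ D) :
    IsExtensionAt r τ D a R ∨ IsExtensionAt r τ D b R := by
  classical
  obtain ⟨σ, C⟩ := R
  obtain ⟨hd, hc⟩ := hR
  simp only at h1 h2 hd hc
  have hc1 := Finset.card_le_card h1
  have hc2 := Finset.card_le_card h2
  by_cases hC : C = D
  · subst hC
    have : (σ \ τ).card = 1 := by
      rw [Finset.card_sdiff_of_subset h1]; omega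
    obtain ⟨x, hx⟩ := Finset.card_eq_one.1 this
    have hx' : x ∈ σ \ τ := by rw [hx]; simp
    have hxτ := (Finset.mem_sdiff.1 hx').2
    have hσ : σ = insert x τ := by
      rw [Finset.insert_eq, ← hx, Finset.sdiff_union_of_subset h1]
    subst hσ
    -- an index in whose ranking `x` is least is `a` or `b`
    have hk : ∀ k ∈ C, (∀ s ∈ τ, r k x ≤ r k s) → k = a ∨ k = b := by
      intro k hk hks
      obtain ⟨t, ht, htmin⟩ := Finset.exists_min_image τ (r k) hτ
      obtain ⟨l, hl, hls⟩ := hd t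
      rcases hpair t ht k hk l hl htmin (fun s hs => hls s (Finset.mem_insert_of_mem hs)) with
        rfl | ⟨h, -⟩ | ⟨h, -⟩
      · have := hr k (le_antisymm (hks t ht) (hls x (Finset.mem_insert_self _ _)))
        exact absurd (this ▸ ht) hxτ
      · exact Or.inl h
      · exact Or.inr h
    have hnot : ¬ ((∀ s ∈ τ, r a x ≤ r a s) ∧ (∀ s ∈ τ, r b x ≤ r b s)) := by
      rintro ⟨hxa, hxb⟩
      obtain ⟨t, ht, hta, htb⟩ := hab
      obtain ⟨l, hl, hls⟩ := hd t
      have hlx := hls x (Finset.mem_insert_self _ _)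
      have hlt : ∀ s ∈ τ, r l t ≤ r l s := fun s hs => hls s (Finset.mem_insert_of_mem hs)
      have : l = a ∨ l = b := by
        obtain ⟨k, hkC, hks⟩ := hd x
        have hks' : ∀ s ∈ τ, r k x ≤ r k s := fun s hs => hks s (Finset.mem_insert_of_mem hs)
        rcases hk k hkC hks' with rfl | rfl
        · rcases hpair t ht k hkC l hl hta hlt with h | ⟨-, h⟩ | ⟨-, h⟩
          · exact Or.inl h.symm
          · exact Or.inr h
          · exact Or.inl h
        · rcases hpair t ht k hkC l hl htb hlt with h | ⟨-, h⟩ | ⟨-, h⟩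
          · exact Or.inr h.symm
          · exact Or.inr h
          · exact Or.inl h
      have hxt : x = t := by
        rcases this with rfl | rfl
        · exact hr l (le_antisymm (hxa t ht) hlx)
        · exact hr l (le_antisymm (hxb t ht) hlx)
      exact hxτ (hxt ▸ ht)
    have hout : ∀ c d : I, (∀ s ∈ τ, r c x ≤ r c s) → (∀ k ∈ C, (∀ s ∈ τ, r k x ≤ r k s) →
        k = c ∨ k = d) → ¬ ((∀ s ∈ τ, r c x ≤ r c s) ∧ (∀ s ∈ τ, r d x ≤ r d s)) →
        IsExtensionAt r τ C c (insert x τ, C) := by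
      intro c d hcx hk hn
      refine Or.inr ⟨x, rfl, rfl, fun i hi hic => ?_⟩
      by_contra! hcon
      rcases hk i hi hcon with h | h
      · exact hic h
      · exact hn ⟨hcx, h ▸ hcon⟩
    obtain ⟨k, hkC, hks⟩ := hd x
    have hks' : ∀ s ∈ τ, r k x ≤ r k s := fun s hs => hks s (Finset.mem_insert_of_mem hs)
    rcases hk k hkC hks' with rfl | rfl
    · exact Or.inl (hout k b hks' hk hnot)
    · exact Or.inr (hout k a hks' (fun k hk1 hk2 => (hk k hk1 hk2).symm) (fun h => hnot h.symm))
  · have hlt := Finset.card_lt_card (Finset.ssubset_iff_subset_ne.2 ⟨h2, hC⟩)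
    have hσ : τ = σ := Finset.eq_of_subset_of_card_le h1 (by omega)
    subst hσ
    have : (D \ C).card = 1 := by
      rw [Finset.card_sdiff_of_subset h2]; omega
    obtain ⟨j, hj⟩ := Finset.card_eq_one.1 this
    have hj' : j ∈ D \ C := by rw [hj]; simp
    have hCj : C = D.erase j := by
      rw [← Finset.sdiff_singleton_eq_erase, ← hj, Finset.sdiff_sdiff_eq_self h2]
    obtain ⟨t, ht, htmin⟩ := Finset.exists_min_image τ (r j) hτ
    obtain ⟨l, hl, hls⟩ := hd t
    rcases hpair t ht j (Finset.mem_sdiff.1 hj').1 l (h2 hl) htmin hls with h | ⟨h, -⟩ | ⟨h, -⟩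
    · exact absurd (h ▸ hl) (Finset.mem_sdiff.1 hj').2
    · exact Or.inl (Or.inl ⟨rfl, h ▸ hCj⟩)
    · exact Or.inr (Or.inl ⟨rfl, h ▸ hCj⟩)

theorem IsExtensionAt.subset {r : I → T → ℕ} {τ : Finset T} {D : Finset I} {a : I}
    {R : Finset T × Finset I} (h : IsExtensionAt r τ D a R) : τ ⊆ R.1 ∧ R.2 ⊆ D := by
  rcases h with ⟨h1, h2⟩ | ⟨x, h1, h2, -⟩
  · rw [h1, h2]; exact ⟨subset_rfl, Finset.erase_subset _ _⟩
  · rw [h1, h2]; exact ⟨Finset.subset_insert _ _, subset_rfl⟩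

-- The two rooms are the pivots at `a` and at `b`. They differ: a point inserted by both would
-- exceed the least element of `τ` in every ranking of `D`, against dominance.
open Classical in
theorem card_rooms_eq_two [Fintype T] [Fintype I] {r : I → T → ℕ}
    (hr : ∀ i, Function.Injective (r i)) {τ : Finset T} {D : Finset I} (hτ : τ.Nonempty)
    (hdom : DominantFor r τ D) (hcard : D.card = τ.card + 1) :
    (Finset.univ.filter fun R : Finset T × Finset I =>
      IsRoom r R ∧ τ ⊆ R.1 ∧ R.2 ⊆ D).card = 2 := by
  obtain ⟨a, ha, b, hb, hne, hab, hpair⟩ := exists_pair_common_min hr hτ hdom hcard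
  have hmin : ∀ c d : I, (∀ t ∈ τ, ∀ k ∈ D, ∀ l ∈ D, (∀ s ∈ τ, r k t ≤ r k s) →
      (∀ s ∈ τ, r l t ≤ r l s) → k = l ∨ (k = c ∧ l = d) ∨ (k = d ∧ l = c)) → c ≠ d → d ∈ D →
      (∃ t ∈ τ, (∀ s ∈ τ, r c t ≤ r c s) ∧ ∀ s ∈ τ, r d t ≤ r d s) →
      ∀ t ∈ τ, ∃ k ∈ D, k ≠ c ∧ ∀ s ∈ τ, r k t ≤ r k s := by
    intro c d hp hcd hd ⟨t₀, ht₀, h1, h2⟩ t ht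
    obtain ⟨k, hk, hks⟩ := hdom t
    by_cases hkc : k = c
    · subst hkc
      have := hr k (le_antisymm (hks t₀ ht₀) (h1 t ht))
      subst this
      exact ⟨d, hd, hcd.symm, h2⟩
    · exact ⟨k, hk, hkc, hks⟩
  obtain ⟨A, ⟨hA1, hA2⟩, hA⟩ := existsUnique_isExtensionAt hr hdom hcard ha
    (hmin a b hpair hne hb hab)
  obtain ⟨B, ⟨hB1, hB2⟩, hB⟩ := existsUnique_isExtensionAt hr hdom hcard hb
    (hmin b a (fun t ht k hk l hl h1 h2 => by
      rcases hpair t ht k hk l hl h1 h2 with h | h | h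
      · exact Or.inl h
      · exact Or.inr (Or.inr h)
      · exact Or.inr (Or.inl h)) hne.symm ha
      (by obtain ⟨t, ht, h1, h2⟩ := hab; exact ⟨t, ht, h2, h1⟩))
  rw [Finset.card_eq_two]
  refine ⟨A, B, ?_, ?_⟩
  · rintro rfl
    rcases hA2 with ⟨h1, h2⟩ | ⟨x, h1, h2, h3⟩ <;> rcases hB2 with ⟨h1', h2'⟩ | ⟨x', h1', h2', h3'⟩
    · have : a ∈ D.erase b := Finset.mem_erase.2 ⟨hne, ha⟩
      rw [← h2', h2] at this
      exact absurd rfl (Finset.ne_of_mem_erase this)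
    · have h3 : D.erase a = D := h2.symm.trans h2'
      rw [← h3] at ha
      exact absurd ha (Finset.notMem_erase a D)
    · have h3 : D.erase b = D := h2'.symm.trans h2
      rw [← h3] at hb
      exact absurd hb (Finset.notMem_erase b D)
    · have hx : x ∈ insert x' τ := by rw [← h1', h1]; exact Finset.mem_insert_self _ _
      have hxτ : x ∉ τ := by
        intro hx'
        have := hA1.2
        rw [h1, h2, Finset.insert_eq_of_mem hx'] at this
        omega
      obtain rfl : x = x' := by
        rcases Finset.mem_insert.1 hx with h | h
        · exact h
        · exact absurd h hxτ
      obtain ⟨i, hi, his⟩ := hdom x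
      by_cases hia : i = a
      · obtain ⟨s, hs, hlt⟩ := h3' i hi (hia ▸ hne)
        exact absurd (his s hs) (not_le.2 hlt)
      · obtain ⟨s, hs, hlt⟩ := h3 i hi hia
        exact absurd (his s hs) (not_le.2 hlt)
  · ext R
    simp only [Finset.mem_filter, Finset.mem_univ, true_and, Finset.mem_insert,
      Finset.mem_singleton]
    constructor
    · rintro ⟨h1, h2, h3⟩
      rcases isExtensionAt_of_subset hr hcard hab hpair hτ h1 h2 h3 with h | h
      · exact Or.inl (hA R ⟨h1, h⟩)
      · exact Or.inr (hB R ⟨h1, h⟩)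
    · rintro (rfl | rfl)
      · exact ⟨hA1, hA2.subset⟩
      · exact ⟨hB1, hB2.subset⟩

-- The empty set is the only door with a single room, which is what makes the total count odd.
open Classical in
theorem card_rooms_empty [Fintype T] [Fintype I] {r : I → T → ℕ}
    (hr : ∀ i, Function.Injective (r i)) (i₀ : I) :
    (Finset.univ.filter fun R : Finset T × Finset I =>
      IsRoom r R ∧ ∅ ⊆ R.1 ∧ R.2 ⊆ {i₀}).card = 1 := by
  obtain ⟨A, ⟨hA1, hA2⟩, hA⟩ := existsUnique_isExtensionAt (τ := (∅ : Finset T)) (D := {i₀}) hr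
    (fun y => ⟨i₀, by simp, by simp⟩) (by simp) (a := i₀) (by simp) (by simp)
  rw [Finset.card_eq_one]
  refine ⟨A, ?_⟩
  ext R
  simp only [Finset.mem_filter, Finset.mem_univ, true_and, Finset.mem_singleton]
  constructor
  · rintro ⟨h1, -, h3⟩
    refine hA R ⟨h1, ?_⟩
    rcases Finset.subset_singleton_iff.1 h3 with h | h
    · left
      have := h1.2
      rw [h, Finset.card_empty, Finset.card_eq_zero] at this
      simp [this, h]
    · right
      have := h1.2
      rw [h, Finset.card_singleton, Finset.card_eq_one] at this
      obtain ⟨x, hx⟩ := this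
      exact ⟨x, by simp [hx], h, fun i hi hne => absurd (Finset.mem_singleton.1 hi) hne⟩
  · rintro rfl
    exact ⟨hA1, hA2.subset⟩

/-- A set of points that have distinct colours other than `i₀`, and lack at most `i₀` from `C`. -/
def IsAlmostRainbow (c : T → I) (i₀ : I) (C : Finset I) (τ : Finset T) : Prop :=
  Set.InjOn c τ ∧ i₀ ∉ τ.image c ∧ C ⊆ insert i₀ (τ.image c)

-- The count is zero or two. If `σ` itself qualifies, `C` lacks one index besides those needed, and
-- the point of that colour may be kept or dropped. Otherwise a qualifying `τ` omits one point `x`,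
-- whose colour repeats that of some `x'`, and either of the two may be omitted. The colour of `x`
-- cannot be `i₀`, since `C` is not the set of colours of `σ`.
open Classical in
theorem even_card_almostRainbow [Fintype T] (c : T → I) (i₀ : I)
    {σ : Finset T} {C : Finset I} (hcard : σ.card = C.card) (hne : C ≠ σ.image c) :
    Even (Finset.univ.filter fun τ : Finset T => τ ⊆ σ ∧ IsAlmostRainbow c i₀ C τ).card := by
  by_cases hσ : IsAlmostRainbow c i₀ C σ
  · obtain ⟨hinj, hi₀, hC⟩ := hσ
    have hci : (σ.image c).card = σ.card := Finset.card_image_of_injOn hinj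
    have hD : (insert i₀ (σ.image c)).card = σ.card + 1 := by
      rw [Finset.card_insert_of_notMem hi₀, hci]
    have : (insert i₀ (σ.image c) \ C).card = 1 := by
      rw [Finset.card_sdiff_of_subset hC]; omega
    obtain ⟨k, hk⟩ := Finset.card_eq_one.1 this
    have hk' : k ∈ insert i₀ (σ.image c) \ C := by rw [hk]; simp
    obtain ⟨hk1, hkC⟩ := Finset.mem_sdiff.1 hk'
    have hCk : C = (insert i₀ (σ.image c)).erase k := by
      rw [← Finset.sdiff_singleton_eq_erase, ← hk, Finset.sdiff_sdiff_eq_self hC]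
    have hki : k ≠ i₀ := by
      rintro rfl
      rw [Finset.erase_insert hi₀] at hCk
      exact hne hCk
    obtain ⟨x, hx, rfl⟩ := Finset.mem_image.1 ((Finset.mem_insert.1 hk1).resolve_left hki)
    have him : (σ.erase x).image c = (σ.image c).erase (c x) := by
      ext i
      simp only [Finset.mem_image, Finset.mem_erase]
      constructor
      · rintro ⟨t, ⟨h1, h2⟩, rfl⟩
        exact ⟨fun h => h1 (hinj h2 hx h), t, h2, rfl⟩
      · rintro ⟨h1, t, h2, rfl⟩
        exact ⟨t, ⟨fun h => h1 (h ▸ rfl), h2⟩, rfl⟩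
    have : (Finset.univ.filter fun τ : Finset T => τ ⊆ σ ∧ IsAlmostRainbow c i₀ C τ)
        = {σ, σ.erase x} := by
      ext τ
      simp only [Finset.mem_filter, Finset.mem_univ, true_and, Finset.mem_insert,
        Finset.mem_singleton]
      constructor
      · rintro ⟨hτ, -, -, h⟩
        by_cases hxτ : x ∈ τ
        · left
          refine Finset.Subset.antisymm hτ fun t ht => ?_
          by_cases htx : t = x
          · exact htx ▸ hxτ
          · have : c t ∈ C := by
              rw [hCk]
              exact Finset.mem_erase.2 ⟨fun h => htx (hinj ht hx h),
                Finset.mem_insert_of_mem (Finset.mem_image_of_mem c ht)⟩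
            rcases Finset.mem_insert.1 (h this) with h | h
            · exact absurd (h ▸ Finset.mem_image_of_mem c ht) hi₀
            · obtain ⟨t', ht', he⟩ := Finset.mem_image.1 h
              rwa [← hinj (hτ ht') ht he]
        · right
          refine Finset.Subset.antisymm (fun t ht => Finset.mem_erase.2
            ⟨fun h => hxτ (h ▸ ht), hτ ht⟩) fun t ht => ?_
          obtain ⟨htx, ht⟩ := Finset.mem_erase.1 ht
          have : c t ∈ C := by
            rw [hCk]
            exact Finset.mem_erase.2 ⟨fun h => htx (hinj ht hx h),
              Finset.mem_insert_of_mem (Finset.mem_image_of_mem c ht)⟩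
          rcases Finset.mem_insert.1 (h this) with h | h
          · exact absurd (h ▸ Finset.mem_image_of_mem c ht) hi₀
          · obtain ⟨t', ht', he⟩ := Finset.mem_image.1 h
            rwa [← hinj (hτ ht') ht he]
      · rintro (rfl | rfl)
        · exact ⟨subset_rfl, hinj, hi₀, hC⟩
        · refine ⟨Finset.erase_subset _ _, hinj.mono (by simp), ?_, ?_⟩
          · exact fun h => hi₀ (Finset.image_subset_image (Finset.erase_subset _ _) h)
          · rw [him, hCk, Finset.erase_insert_of_ne hki.symm]
    rw [this, Finset.card_pair]
    · exact even_two
    · exact fun h => Finset.notMem_erase x σ (h ▸ hx)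
  · by_cases hex : ∃ τ, τ ⊆ σ ∧ IsAlmostRainbow c i₀ C τ
    · obtain ⟨τ, hτ, hinj, hi₀, hC⟩ := hex
      have hss : τ ≠ σ := by
        rintro rfl
        exact hσ ⟨hinj, hi₀, hC⟩
      have hlt := Finset.card_lt_card (Finset.ssubset_iff_subset_ne.2 ⟨hτ, hss⟩)
      have hci : (τ.image c).card = τ.card := Finset.card_image_of_injOn hinj
      have hD : (insert i₀ (τ.image c)).card = τ.card + 1 := by
        rw [Finset.card_insert_of_notMem hi₀, hci]
      have hCeq : C = insert i₀ (τ.image c) := Finset.eq_of_subset_of_card_le hC (by omega)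
      have : (σ \ τ).card = 1 := by
        rw [Finset.card_sdiff_of_subset hτ]
        rw [← hCeq] at hD
        omega
      obtain ⟨x, hx⟩ := Finset.card_eq_one.1 this
      have hx' : x ∈ σ \ τ := by rw [hx]; simp
      have hxτ := (Finset.mem_sdiff.1 hx').2
      obtain rfl : σ = insert x τ := by
        rw [Finset.insert_eq, ← hx, Finset.sdiff_union_of_subset hτ]
      have hcx : c x ∈ τ.image c := by
        by_contra hcx
        by_cases hxi : c x = i₀
        · exact hne (by rw [hCeq, Finset.image_insert, hxi])
        · refine hσ ⟨?_, ?_, ?_⟩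
          · rw [Finset.coe_insert, Set.injOn_insert (by simpa using hxτ)]
            exact ⟨hinj, by simpa using hcx⟩
          · rw [Finset.image_insert, Finset.mem_insert]
            rintro (h | h)
            · exact hxi h.symm
            · exact hi₀ h
          · exact hC.trans (Finset.insert_subset_insert _
              (Finset.image_subset_image (Finset.subset_insert _ _)))
      obtain ⟨x', hx'τ, hxx⟩ := Finset.mem_image.1 hcx
      have hxne : x' ≠ x := fun h => hxτ (h ▸ hx'τ)
      have him : ((insert x τ).erase x').image c = τ.image c := by
        ext i
        simp only [Finset.mem_image, Finset.mem_erase, Finset.mem_insert]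
        constructor
        · rintro ⟨t, ⟨h1, rfl | h2⟩, rfl⟩
          · exact ⟨x', hx'τ, hxx⟩
          · exact ⟨t, h2, rfl⟩
        · rintro ⟨t, h2, rfl⟩
          by_cases h : t = x'
          · exact ⟨x, ⟨hxne.symm, Or.inl rfl⟩, by rw [h, hxx]⟩
          · exact ⟨t, ⟨h, Or.inr h2⟩, rfl⟩
      have : (Finset.univ.filter fun τ' : Finset T => τ' ⊆ insert x τ ∧ IsAlmostRainbow c i₀ C τ')
          = {τ, (insert x τ).erase x'} := by
        have hcardσ : (insert x τ).card = τ.card + 1 := Finset.card_insert_of_notMem hxτ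
        ext τ'
        simp only [Finset.mem_filter, Finset.mem_univ, true_and, Finset.mem_insert,
          Finset.mem_singleton]
        constructor
        · rintro ⟨hτ', hinj', hi₀', hC'⟩
          have hge : τ.card ≤ τ'.card := by
            have h1 := Finset.card_le_card hC'
            rw [Finset.card_insert_of_notMem hi₀', Finset.card_image_of_injOn hinj', hCeq, hD] at h1
            omega
          by_cases hxm : x ∈ τ'
          · right
            have hx'm : x' ∉ τ' := fun h => hxne (hinj' h hxm hxx)
            refine Finset.eq_of_subset_of_card_le (fun t ht => Finset.mem_erase.2
              ⟨fun h => hx'm (h ▸ ht), hτ' ht⟩) ?_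
            rw [Finset.card_erase_of_mem (Finset.mem_insert_of_mem hx'τ), hcardσ]
            omega
          · left
            refine Finset.eq_of_subset_of_card_le (fun t ht => ?_) hge
            rcases Finset.mem_insert.1 (hτ' ht) with h | h
            · exact absurd (h ▸ ht) hxm
            · exact h
        · rintro (rfl | rfl)
          · exact ⟨hτ, hinj, hi₀, hC⟩
          · refine ⟨Finset.erase_subset _ _, ?_, by rwa [him], by rwa [him]⟩
            apply Finset.injOn_of_card_image_eq
            rw [him, hci, Finset.card_erase_of_mem (Finset.mem_insert_of_mem hx'τ), hcardσ]
            rfl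
      rw [this, Finset.card_pair]
      · exact even_two
      · exact fun h => Finset.notMem_erase x' (insert x τ) (h ▸ hx'τ)
    · rw [Finset.filter_false_of_mem]
      · simp
      · exact fun τ _ h => hex ⟨τ, h⟩

/-- Scarf's lemma: some nonempty set of points is dominant for the set of its colours. -/
theorem exists_dominantFor_image [Fintype T] [Nonempty T] [Fintype I] {r : I → T → ℕ}
    (hr : ∀ i, Function.Injective (r i)) (c : T → I) :
    ∃ σ : Finset T, σ.Nonempty ∧ DominantFor r σ (σ.image c) := by
  classical
  by_contra! hcon
  let i₀ : I := c (Classical.arbitrary T)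
  let rooms := Finset.univ.filter fun R : Finset T × Finset I => IsRoom r R
  let doors := Finset.univ.filter fun τ : Finset T =>
    Set.InjOn c τ ∧ i₀ ∉ τ.image c ∧ DominantFor r τ (insert i₀ (τ.image c))
  -- Incidences of doors and rooms are counted twice: without a solution each room has an even
  -- number of doors, while each door has two rooms except the empty one, which has one.
  have hcount := Finset.sum_card_bipartiteAbove_eq_sum_card_bipartiteBelow (s := doors) (t := rooms)
    (fun τ R => τ ⊆ R.1 ∧ R.2 ⊆ insert i₀ (τ.image c))
  have heven : Even (∑ R ∈ rooms, (doors.bipartiteBelow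
      (fun τ R => τ ⊆ R.1 ∧ R.2 ⊆ insert i₀ (τ.image c)) R).card) := by
    refine Finset.even_sum _ fun R hR => ?_
    obtain ⟨hd, hc⟩ : IsRoom r R := by simpa [rooms] using hR
    have hne : R.2 ≠ R.1.image c := by
      intro h
      rcases R.1.eq_empty_or_nonempty with h0 | h0
      · obtain ⟨i, hi, -⟩ := hd (Classical.arbitrary T)
        rw [h, h0] at hi
        simp at hi
      · exact hcon R.1 h0 (h ▸ hd)
    have h := even_card_almostRainbow c i₀ hc hne
    suffices e : doors.bipartiteBelow (fun τ R => τ ⊆ R.1 ∧ R.2 ⊆ insert i₀ (τ.image c)) R =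
        Finset.univ.filter fun τ : Finset T => τ ⊆ R.1 ∧ IsAlmostRainbow c i₀ R.2 τ by
      rw [e]
      convert h
    ext τ
    simp only [doors, Finset.bipartiteBelow, Finset.mem_filter, Finset.mem_univ, true_and]
    constructor
    · rintro ⟨⟨h1, h2, -⟩, h4, h5⟩
      exact ⟨h4, h1, h2, h5⟩
    · rintro ⟨h4, h1, h2, h5⟩
      exact ⟨⟨h1, h2, hd.mono h4 h5⟩, h4, h5⟩
  have hempty : (∅ : Finset T) ∈ doors := by
    simp [doors, DominantFor]
  have hodd : Odd (∑ τ ∈ doors, (rooms.bipartiteAbove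
      (fun τ R => τ ⊆ R.1 ∧ R.2 ⊆ insert i₀ (τ.image c)) τ).card) := by
    rw [← Finset.add_sum_erase _ _ hempty]
    refine Odd.add_even ?_ (Finset.even_sum _ fun τ hτ => ?_)
    · suffices h : (rooms.bipartiteAbove
          (fun τ R => τ ⊆ R.1 ∧ R.2 ⊆ insert i₀ (τ.image c)) ∅).card = 1 by
        rw [h]; exact odd_one
      rw [← card_rooms_empty hr i₀]
      congr 1
      ext R
      simp [rooms, Finset.bipartiteAbove]
    · obtain ⟨hτ0, hτ⟩ := Finset.mem_erase.1 hτ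
      obtain ⟨h1, h2, h3⟩ : Set.InjOn c τ ∧ i₀ ∉ τ.image c ∧
        DominantFor r τ (insert i₀ (τ.image c)) := by simpa only [doors, Finset.mem_filter,
          Finset.mem_univ, true_and] using hτ
      suffices h : (rooms.bipartiteAbove
          (fun τ R => τ ⊆ R.1 ∧ R.2 ⊆ insert i₀ (τ.image c)) τ).card = 2 by
        rw [h]; exact even_two
      rw [← card_rooms_eq_two hr (Finset.nonempty_iff_ne_empty.2 hτ0) h3
        (by rw [Finset.card_insert_of_notMem h2, Finset.card_image_of_injOn h1])]
      congr 1
      ext R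
      simp [rooms, Finset.bipartiteAbove]
  rw [hcount] at hodd
  exact (Nat.not_even_iff_odd.2 hodd) heven

end Scarf

/-! ### The fixed point theorems of Brouwer and Kakutani -/

section FixedPoint

/-- Any colouring of the points of a grid on the simplex by the coordinates admits a point near
which every non-negligible coordinate occurs as a colour. -/
theorem exists_grid_point_near_colours {I : Type*} [Fintype I] (m : ℕ) (c : (I → ℕ) → I) :
    ∃ x : I → ℕ, ∑ i, x i = m ∧ ∀ i, x i ≤ Fintype.card I ∨ ∃ s : I → ℕ, ∑ k, s k = m ∧ c s = i ∧
      ∀ k, x k ≤ s k + Fintype.card I ∧ s k ≤ x k + Fintype.card I := by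
  classical
  let T := {x : I → ℕ // x ∈ Finset.piAntidiag Finset.univ m}
  have hT : ∀ x : T, ∑ i, x.1 i = m := fun x => by
    have := x.2
    rw [Finset.mem_piAntidiag] at this
    exact this.1
  have hT' : ∀ x : I → ℕ, ∑ i, x i = m → x ∈ Finset.piAntidiag Finset.univ m := fun x hx => by
    rw [Finset.mem_piAntidiag]
    exact ⟨hx, by simp⟩
  let _ : Fintype T := FinsetCoe.fintype _
  let i₁ : I := c 0
  have : Nonempty T := ⟨⟨Pi.single i₁ m, hT' _ (by simp)⟩⟩
  let e := Fintype.equivFin T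
  let N := Fintype.card T
  -- Points are ranked by their `i`-th coordinate, ties being broken by the enumeration `e`, whose
  -- values are below `N`.
  let r : I → T → ℕ := fun i x => x.1 i * N + e x
  have hle : ∀ i x s, r i x ≤ r i s → x.1 i ≤ s.1 i := by
    intro i x s h
    by_contra! hlt
    have h1 : (s.1 i + 1) * N ≤ x.1 i * N := Nat.mul_le_mul_right _ hlt
    have h2 := (e s).2
    simp only [r] at h
    rw [add_mul] at h1
    omega
  have hr : ∀ i, Function.Injective (r i) := by
    intro i x y h
    have h1 := le_antisymm (hle i x y h.le) (hle i y x h.ge)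
    simp only [r, h1] at h
    exact e.injective (Fin.ext (by omega))
  obtain ⟨σ, ⟨x, hx⟩, hσ⟩ := exists_dominantFor_image hr (fun t : T => c t.1)
  set C := σ.image (fun t : T => c t.1)
  have hmin : ∀ i, ∃ t ∈ σ, ∀ s ∈ σ, t.1 i ≤ s.1 i :=
    fun i => Finset.exists_min_image σ (fun t => t.1 i) ⟨x, hx⟩
  choose μ hμσ hμ using hmin
  -- Otherwise a grid point exceeds all the minima over `σ` in the coordinates of `C`, the surplus
  -- mass being put on the coordinate `c x.1`; this contradicts dominance.
  have hsum : m + 1 ≤ ∑ i ∈ C, ((μ i).1 i + 1) := by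
    by_contra! hlt
    have hxC : c x.1 ∈ C := Finset.mem_image_of_mem (fun t : T => c t.1) hx
    set y : I → ℕ := fun i => if i ∈ C then
      (μ i).1 i + 1 + (if i = c x.1 then m - ∑ i ∈ C, ((μ i).1 i + 1) else 0) else 0 with hy
    have hysum : ∑ i, y i = m := by
      simp only [hy]
      rw [Finset.sum_ite_mem, Finset.univ_inter, Finset.sum_add_distrib, Finset.sum_ite_eq' C,
        if_pos hxC]
      omega
    obtain ⟨i, hi, his⟩ := hσ ⟨y, hT' y hysum⟩
    have h1 := hle _ _ _ (his _ (hμσ i))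
    simp only [hy, if_pos hi] at h1
    omega
  -- The minima over `C` nearly exhaust the mass `m`, so little is left for rising above them or for
  -- coordinates outside `C`. Hence `σ` has small diameter.
  have hdiff : ∀ s ∈ σ, ∑ i ∈ C, (s.1 i - (μ i).1 i) + ∑ i ∈ Finset.univ \ C, s.1 i + 1 ≤
      Fintype.card I := by
    intro s hs
    have h1 : ∑ i ∈ C, (s.1 i - (μ i).1 i) + ∑ i ∈ C, (μ i).1 i = ∑ i ∈ C, s.1 i := by
      rw [← Finset.sum_add_distrib]
      exact Finset.sum_congr rfl fun i _ => Nat.sub_add_cancel (hμ i s hs)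
    have h2 : ∑ i ∈ Finset.univ \ C, s.1 i + ∑ i ∈ C, s.1 i = m :=
      (Finset.sum_sdiff (Finset.subset_univ C)).trans (hT s)
    rw [Finset.sum_add_distrib, Finset.sum_const, smul_eq_mul, mul_one] at hsum
    have h3 := Finset.card_le_univ C
    omega
  have hin : ∀ s ∈ σ, ∀ i ∈ C, s.1 i ≤ (μ i).1 i + Fintype.card I := by
    intro s hs i hi
    have h1 := hdiff s hs
    have h2 := Finset.single_le_sum (f := fun i => s.1 i - (μ i).1 i) (fun _ _ => Nat.zero_le _) hi
    omega
  have hout : ∀ s ∈ σ, ∀ i ∉ C, s.1 i ≤ Fintype.card I := by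
    intro s hs i hi
    have h1 := hdiff s hs
    have h2 := Finset.single_le_sum (f := fun i => s.1 i) (fun _ _ => Nat.zero_le _)
      (Finset.mem_sdiff.2 ⟨Finset.mem_univ i, hi⟩)
    omega
  refine ⟨x.1, hT x, fun i => ?_⟩
  by_cases hi : i ∈ C
  · right
    obtain ⟨s, hs, hsi⟩ := Finset.mem_image.1 hi
    refine ⟨s.1, hT s, hsi, fun k => ?_⟩
    by_cases hk : k ∈ C
    · have h1 := hin x hx k hk
      have h2 := hin s hs k hk
      have h3 := hμ k x hx
      have h4 := hμ k s hs
      omega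
    · have h1 := hout x hx k hk
      have h2 := hout s hs k hk
      omega
  · exact Or.inl (hout x hx i hi)

/-- Brouwer's fixed point theorem for the standard simplex. -/
theorem exists_fixedPoint_stdSimplex {I : Type*} [Fintype I] [Nonempty I]
    {f : (I → ℝ) → I → ℝ} (hf : ContinuousOn f (stdSimplex ℝ I))
    (hmaps : Set.MapsTo f (stdSimplex ℝ I) (stdSimplex ℝ I)) :
    ∃ x ∈ stdSimplex ℝ I, f x = x := by
  classical
  have happrox : ∀ ε > 0, ∃ x ∈ stdSimplex ℝ I, ∀ i, x i - f x i ≤ ε := by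
    intro ε hε
    obtain ⟨δ, hδ, hfδ⟩ := Metric.uniformContinuousOn_iff.1
      ((isCompact_stdSimplex ℝ I).uniformContinuousOn_of_continuous hf) (ε / 2) (half_pos hε)
    set n := Fintype.card I
    obtain ⟨m, hm⟩ := exists_nat_gt ((n : ℝ) / min δ (ε / 2))
    have hmin : 0 < min δ (ε / 2) := lt_min hδ (half_pos hε)
    have hm0 : (0 : ℝ) < m := lt_of_le_of_lt (by positivity) hm
    have hnm : (n : ℝ) / m < min δ (ε / 2) := by
      rw [div_lt_iff₀ hmin] at hm
      rw [div_lt_iff₀ hm0]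
      linarith
    let emb : (I → ℕ) → I → ℝ := fun s i => s i / m
    have hemb : ∀ s : I → ℕ, ∑ i, s i = m → emb s ∈ stdSimplex ℝ I := by
      intro s hs
      refine ⟨fun i => by positivity, ?_⟩
      simp only [emb]
      rw [← Finset.sum_div, ← Nat.cast_sum, hs, div_self hm0.ne']
    -- Both points have coordinate sum one, so some coordinate does not decrease under `f`; it
    -- serves as the colour.
    have hcol : ∀ s : I → ℕ, ∃ i, ∑ i, s i = m → emb s i ≤ f (emb s) i := by
      intro s
      by_cases hs : ∑ i, s i = m
      · obtain ⟨i, -, hi⟩ := Finset.exists_le_of_sum_le (s := Finset.univ) (f := emb s)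
          (g := f (emb s)) Finset.univ_nonempty
          (by rw [(hemb s hs).2, (hmaps (hemb s hs)).2])
        exact ⟨i, fun _ => hi⟩
      · exact ⟨Classical.arbitrary I, fun h => absurd h hs⟩
    choose c hc using hcol
    obtain ⟨x, hx, hxi⟩ := exists_grid_point_near_colours m c
    refine ⟨emb x, hemb x hx, fun i => ?_⟩
    rcases hxi i with h | ⟨s, hs, hsi, hk⟩
    · have h1 : emb x i ≤ n / m := div_le_div_of_nonneg_right (by exact_mod_cast h) hm0.le
      have h2 := (hmaps (hemb x hx)).1 i
      have h3 := hnm.trans_le (min_le_right _ _)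
      linarith
    · have hclose : ∀ k, |emb s k - emb x k| ≤ n / m := by
        intro k
        simp only [emb]
        rw [← sub_div, abs_div, abs_of_pos hm0]
        refine div_le_div_of_nonneg_right ?_ hm0.le
        have h1 : (x k : ℝ) ≤ s k + n := by exact_mod_cast (hk k).1
        have h2 : (s k : ℝ) ≤ x k + n := by exact_mod_cast (hk k).2
        rw [abs_le]
        constructor <;> linarith
      have hd : dist (emb s) (emb x) < δ := by
        refine lt_of_le_of_lt ?_ (hnm.trans_le (min_le_left _ _))
        rw [dist_pi_le_iff (by positivity)]
        intro k
        rw [Real.dist_eq]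
        exact hclose k
      have h1 := hfδ _ (hemb s hs) _ (hemb x hx) hd
      have h2 := (dist_le_pi_dist (f (emb s)) (f (emb x)) i).trans_lt h1
      rw [Real.dist_eq, abs_lt] at h2
      have h3 := hc s hs
      rw [hsi] at h3
      have h4 := (abs_le.1 (hclose i)).1
      have h5 := hnm.trans_le (min_le_right _ _)
      linarith [h2.2]
  -- The largest decrease of a coordinate attains its minimum, which is at most every `ε > 0`. At
  -- the minimizer no coordinate decreases, and equal coordinate sums give a fixed point.
  have hcont : ContinuousOn (fun x => Finset.univ.sup' Finset.univ_nonempty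
      fun i => x i - f x i) (stdSimplex ℝ I) := by
    refine ContinuousOn.finset_sup'_apply _ fun i _ => ?_
    exact (continuous_apply i).continuousOn.sub (continuousOn_pi.1 hf i)
  obtain ⟨x₁, hx₁, -⟩ := happrox 1 one_pos
  obtain ⟨x, hx, hmin⟩ := (isCompact_stdSimplex ℝ I).exists_isMinOn ⟨x₁, hx₁⟩ hcont
  have hle : ∀ i, x i ≤ f x i := by
    intro i
    refine sub_nonpos.1 (le_of_forall_pos_le_add fun ε hε => ?_)
    obtain ⟨y, hy, hyi⟩ := happrox ε hε
    rw [zero_add]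
    refine (Finset.le_sup' (fun i => x i - f x i) (Finset.mem_univ i)).trans ((hmin hy).trans ?_)
    exact Finset.sup'_le _ _ fun i _ => hyi i
  refine ⟨x, hx, funext fun i => ?_⟩
  have := (Finset.sum_eq_sum_iff_of_le (fun i _ => hle i)).1 (hx.2.trans (hmaps hx).2.symm)
  exact (this i (Finset.mem_univ i)).symm

/-- Kakutani's fixed point theorem. -/
theorem exists_mem_of_isClosed_graph {E : Type*} [NormedAddCommGroup E] [NormedSpace ℝ E]
    {K : Set E} (hK : IsCompact K) (hKc : Convex ℝ K) (hKn : K.Nonempty) {F : E → Set E}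
    (hsub : ∀ x ∈ K, F x ⊆ K) (hne : ∀ x ∈ K, (F x).Nonempty) (hconv : ∀ x ∈ K, Convex ℝ (F x))
    (hclosed : IsClosed {q : E × E | q.2 ∈ F q.1}) : ∃ x ∈ K, x ∈ F x := by
  classical
  -- approximate fixed points
  have happrox : ∀ ε > 0, ∃ x ∈ K, x ∈ convexHull ℝ (⋃ y ∈ K ∩ Metric.ball x ε, F y) := by
    intro ε hε
    obtain ⟨t, htK, htf, hcover⟩ := hK.finite_cover_balls hε
    let I := htf.toFinset
    have hIK : ∀ i : I, (i : E) ∈ K := fun i => htK (htf.mem_toFinset.1 i.2)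
    choose g hg using hne
    let y : I → E := fun i => g i (hIK i)
    have hyF : ∀ i : I, y i ∈ F i := fun i => hg i (hIK i)
    have hyK : ∀ i, y i ∈ K := fun i => hsub _ (hIK i) (hyF i)
    -- Tent functions around the points of a finite `ε`-net; normalized, they form a partition of
    -- unity on `K`.
    let b : I → E → ℝ := fun i x => max 0 (ε - dist x i)
    have hb0 : ∀ i x, 0 ≤ b i x := fun i x => le_max_left _ _
    have hbc : ∀ i, Continuous (b i) := fun i => by fun_prop
    have hbpos : ∀ x ∈ K, 0 < ∑ i, b i x := by
      intro x hx
      obtain ⟨i, hi, hxi⟩ := Set.mem_iUnion₂.1 (hcover hx)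
      refine Finset.sum_pos' (fun i _ => hb0 i x)
        ⟨⟨i, htf.mem_toFinset.2 hi⟩, Finset.mem_univ _, ?_⟩
      exact lt_max_of_lt_right (sub_pos.2 (Metric.mem_ball.1 hxi))
    let φ : E → I → ℝ := fun x i => b i x / ∑ k, b k x
    have hφ : ∀ x ∈ K, φ x ∈ stdSimplex ℝ I := fun x hx =>
      ⟨fun i => div_nonneg (hb0 i x) (hbpos x hx).le, by
        simp only [φ]; rw [← Finset.sum_div, div_self (hbpos x hx).ne']⟩
    let ψ : (I → ℝ) → E := fun l => ∑ i, l i • y i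
    have hψ : ∀ l ∈ stdSimplex ℝ I, ψ l ∈ K := fun l hl =>
      hKc.sum_mem (fun i _ => hl.1 i) hl.2 fun i _ => hyK i
    have : Nonempty I := by
      obtain ⟨x, hx⟩ := hKn
      obtain ⟨i, hi, -⟩ := Set.mem_iUnion₂.1 (hcover hx)
      exact ⟨⟨i, htf.mem_toFinset.2 hi⟩⟩
    have hψc : Continuous ψ := by fun_prop
    have hφc : ContinuousOn φ K := by
      refine continuousOn_pi.2 fun i => ?_
      exact (hbc i).continuousOn.div (by fun_prop) fun x hx => (hbpos x hx).ne'
    -- Brouwer's theorem is applied to the weights. At the fixed point, only net points within `ε`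
    -- of `ψ l` have nonzero weight.
    obtain ⟨l, hl, hfix⟩ := exists_fixedPoint_stdSimplex (f := φ ∘ ψ)
      (hφc.comp hψc.continuousOn hψ) (fun l hl => hφ _ (hψ l hl))
    refine ⟨ψ l, hψ l hl, ?_⟩
    have hsum : ψ l = ∑ i ∈ Finset.univ.filter fun i => l i ≠ 0, l i • y i := by
      rw [Finset.sum_filter_of_ne]
      intro i _ h h0
      exact h (by rw [h0, zero_smul])
    rw [hsum]
    refine (convex_convexHull ℝ _).sum_mem (fun i _ => hl.1 i) ?_ fun i hi => ?_
    · rw [Finset.sum_filter_of_ne (fun _ _ h => h)]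
      exact hl.2
    · rw [← hsum]
      refine subset_convexHull ℝ _ (Set.mem_iUnion₂.2 ⟨i, ⟨hIK i, ?_⟩, hyF i⟩)
      have h0 : l i ≠ 0 := (Finset.mem_filter.1 hi).2
      rw [← hfix] at h0
      by_contra hcon
      rw [Metric.mem_ball, dist_comm, not_lt] at hcon
      refine h0 ?_
      simp only [Function.comp_apply, φ, b]
      rw [max_eq_left (sub_nonpos.2 hcon), zero_div]
  have hseq : ∀ n : ℕ, ∃ x ∈ K, x ∈ convexHull ℝ
      (⋃ y ∈ K ∩ Metric.ball x (1 / ((n : ℝ) + 1)), F y) :=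
    fun n => happrox _ Nat.one_div_pos_of_nat
  choose u huK hu using hseq
  obtain ⟨x, hx, θ, hθ, hlim⟩ := hK.tendsto_subseq huK
  refine ⟨x, hx, ?_⟩
  have hFc : ∀ x, IsClosed (F x) := fun x => hclosed.preimage (Continuous.prodMk_right x)
  -- upper hemicontinuity at `x`
  have huhc : ∀ η > 0, ∃ δ > 0, ∀ y ∈ K ∩ Metric.ball x δ, F y ⊆ Metric.cthickening η (F x) := by
    intro η hη
    by_contra! hcon
    have h1 : ∀ n : ℕ, ∃ q : E × E, q.1 ∈ K ∩ Metric.ball x (1 / ((n : ℝ) + 1)) ∧ q.2 ∈ F q.1 ∧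
        q.2 ∉ Metric.cthickening η (F x) := by
      intro n
      obtain ⟨y, hy, hyF⟩ := hcon _ (Nat.one_div_pos_of_nat (n := n))
      obtain ⟨z, hz, hz'⟩ := Set.not_subset.1 hyF
      exact ⟨(y, z), hy, hz, hz'⟩
    choose q hq1 hq2 hq3 using h1
    obtain ⟨z, hz, κ, hκ, hzlim⟩ := hK.tendsto_subseq (x := fun n => (q n).2)
      (fun n => hsub _ (hq1 n).1 (hq2 n))
    have hxlim : Filter.Tendsto (fun n => (q n).1) Filter.atTop (nhds x) := by
      rw [tendsto_iff_dist_tendsto_zero]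
      exact squeeze_zero (fun _ => dist_nonneg) (fun n => (Metric.mem_ball.1 (hq1 n).2).le)
        tendsto_one_div_add_atTop_nhds_zero_nat
    have hzF : z ∈ F x := by
      have := hclosed.mem_of_tendsto ((hxlim.comp hκ.tendsto_atTop).prodMk_nhds hzlim)
        (Filter.Eventually.of_forall fun n => hq2 (κ n))
      exact this
    have hopen : Metric.thickening η (F x) ∈ nhds z :=
      Metric.isOpen_thickening.mem_nhds (Metric.self_subset_thickening hη _ hzF)
    obtain ⟨n, hn⟩ := (hzlim.eventually hopen).exists
    exact hq3 _ (Metric.thickening_subset_cthickening _ _ hn)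
  have hmem : ∀ η > 0, x ∈ Metric.cthickening η (F x) := by
    intro η hη
    obtain ⟨δ, hδ, hsubδ⟩ := huhc η hη
    refine Metric.isClosed_cthickening.mem_of_tendsto hlim ?_
    have h1 : ∀ᶠ n in Filter.atTop, dist ((u ∘ θ) n) x < δ / 2 :=
      (tendsto_iff_dist_tendsto_zero.1 hlim).eventually_lt_const (half_pos hδ)
    have h2 : ∀ᶠ n in Filter.atTop, 1 / ((θ n : ℝ) + 1) < δ / 2 :=
      (tendsto_one_div_add_atTop_nhds_zero_nat.comp hθ.tendsto_atTop).eventually_lt_const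
        (half_pos hδ)
    filter_upwards [h1, h2] with n hn1 hn2
    -- Thickenings of the convex set `F x` are convex, so they absorb the convex hull of the nearby
    -- values.
    refine convexHull_min ?_ ((hconv x hx).cthickening η) (hu (θ n))
    refine Set.iUnion₂_subset fun y hy => hsubδ y ⟨hy.1, ?_⟩
    rw [Metric.mem_ball]
    have h3 := Metric.mem_ball.1 hy.2
    have h4 := dist_triangle y (u (θ n)) x
    simp only [Function.comp_apply] at hn1
    linarith
  rw [← (hFc x).closure_eq, Metric.closure_eq_iInter_cthickening]
  exact Set.mem_iInter₂.2 hmem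

end FixedPoint

/-! ### Serving a demand in the order of a ranking -/

section Rationing

/-- Induction adds the last seller in the order: the earlier ones are unaffected, and the new one
serves what they leave over, up to its own supply. -/
theorem sum_min_max_sub_sum_lt {K : Type*} [LinearOrder K] (s : Finset K) {a : K → ℝ}
    (ha : ∀ k, 0 ≤ a k) {q : ℝ} (hq : 0 ≤ q) :
    ∑ k ∈ s, min (a k) (max 0 (q - ∑ k' ∈ s, if k' < k then a k' else 0)) =
      min q (∑ k ∈ s, a k) := by
  induction s using Finset.induction_on_max with
  | empty => simp [hq]
  | insert m s hm ih =>
    have hms : m ∉ s := fun h => lt_irrefl m (hm m h)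
    rw [Finset.sum_insert hms, Finset.sum_insert hms, Finset.sum_insert hms, if_neg (lt_irrefl m),
      zero_add, Finset.sum_congr rfl fun k hk => if_pos (hm k hk)]
    have : ∑ k ∈ s, min (a k) (max 0 (q - ∑ k' ∈ insert m s, if k' < k then a k' else 0)) =
        min q (∑ k ∈ s, a k) := by
      rw [← ih]
      refine Finset.sum_congr rfl fun k hk => ?_
      rw [Finset.sum_insert hms, if_neg (hm k hk).not_gt, zero_add]
    rw [this]
    have h1 : 0 ≤ ∑ k ∈ s, a k := Finset.sum_nonneg fun k _ => ha k
    have h2 := ha m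
    rcases le_total q (∑ k ∈ s, a k) with h | h
    · rw [min_eq_left h, max_eq_left (sub_nonpos.2 h), min_eq_right h2, min_eq_left (by linarith)]
      ring
    · rw [min_eq_right h, max_eq_right (sub_nonneg.2 h)]
      rcases le_total q (a m + ∑ k ∈ s, a k) with h' | h'
      · rw [min_eq_right (by linarith), min_eq_left h']; ring
      · rw [min_eq_left (by linarith), min_eq_right h']

end Rationing

namespace MixedMarket

/-! ### Monotonicity and continuity of utilities -/

section Utility

variable {A C J : Type*} {S : J → Type*}

/-- If utility fell from `z` to `z'`, non-satiation would give a bundle `z''` further along the same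
axis and better than `z'`. Then `z'` would be worse than both ends of a segment containing it,
against quasi-concavity. -/
theorem utility_le_of_eq_off (M : MixedMarket A C J S) (i : A) {z z' : C ⊕ J → ℝ} (hz : 0 ≤ z)
    {a : C ⊕ J} (hoff : ∀ b, b ≠ a → z' b = z b) (ha : z a ≤ z' a) :
    M.utility i z ≤ M.utility i z' := by
  have hz' : 0 ≤ z' := by
    intro b
    by_cases hb : b = a
    · exact hb ▸ (hz a).trans ha
    · rw [hoff b hb]; exact hz b
  by_contra! hlt
  obtain ⟨z'', hoff', ha', hU⟩ := M.utility_nonsatiated i z' hz' a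
  have hz'' : 0 ≤ z'' := by
    intro b
    by_cases hb : b = a
    · exact hb ▸ (hz' a).trans ha'.le
    · rw [hoff' b hb]; exact hz' b
  have hpos : 0 < z'' a - z a := by linarith
  have hmem := M.utility_quasiconcave i (min (M.utility i z) (M.utility i z''))
    (x := z) ⟨hz, min_le_left _ _⟩ (y := z'') ⟨hz'', min_le_right _ _⟩
    (a := (z'' a - z' a) / (z'' a - z a)) (b := (z' a - z a) / (z'' a - z a))
    (div_nonneg (by linarith) hpos.le) (div_nonneg (by linarith) hpos.le)
    (by rw [← add_div, div_eq_one_iff_eq hpos.ne']; ring)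
  have heq : ((z'' a - z' a) / (z'' a - z a)) • z + ((z' a - z a) / (z'' a - z a)) • z'' = z' := by
    ext b
    simp only [Pi.add_apply, Pi.smul_apply, smul_eq_mul]
    by_cases hb : b = a
    · subst hb
      field_simp
      ring
    · rw [hoff' b hb, hoff b hb]
      field_simp
      ring
  rw [heq] at hmem
  exact absurd hmem.2 (not_le.2 (lt_min hlt hU))

theorem utility_mono [Fintype C] [Fintype J] (M : MixedMarket A C J S) (i : A)
    {z z' : C ⊕ J → ℝ} (hz : 0 ≤ z) (h : z ≤ z') : M.utility i z ≤ M.utility i z' := by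
  classical
  have key : ∀ s : Finset (C ⊕ J), M.utility i z ≤ M.utility i (s.piecewise z' z) := by
    intro s
    induction s using Finset.induction_on with
    | empty => simp
    | insert a s ha ih =>
      refine ih.trans (M.utility_le_of_eq_off i (a := a) ?_ ?_ ?_)
      · intro b
        by_cases hb : b ∈ s
        · simpa [hb] using (hz b).trans (h b)
        · simpa [hb] using hz b
      · intro b hb
        by_cases hbs : b ∈ s <;> simp [hb, hbs, Finset.piecewise]
      · simpa [ha, Finset.piecewise] using h a
  simpa using key Finset.univ

/-- The utility function, extended continuously to the whole space. -/
noncomputable def utilityExt (M : MixedMarket A C J S) (i : A) (z : C ⊕ J → ℝ) : ℝ := M.utility i (z ⊔ 0)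

theorem utilityExt_of_nonneg (M : MixedMarket A C J S) (i : A) {z : C ⊕ J → ℝ} (hz : 0 ≤ z) :
    M.utilityExt i z = M.utility i z := by
  rw [utilityExt, sup_eq_left.2 hz]

theorem continuous_utilityExt (M : MixedMarket A C J S) (i : A) :
    Continuous (M.utilityExt i) :=
  (M.utility_continuous i).comp_continuous
    (continuous_pi fun a => (continuous_apply a).sup continuous_const) fun z => show (0 : C ⊕ J → ℝ) ≤ z ⊔ 0 from le_sup_right

/-- Scaling `z` by a factor slightly below one lowers its positive cost and, by continuity, keeps
the utility above `v`. This later turns weak cost comparisons into strict ones. -/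
theorem exists_cheaper [Fintype C] [Fintype J] (M : MixedMarket A C J S) (i : A)
    {p z : C ⊕ J → ℝ} (hz : 0 ≤ z) {v : ℝ} (hv : v < M.utility i z) (hp : 0 < ∑ a, p a * z a) :
    ∃ z', 0 ≤ z' ∧ v < M.utility i z' ∧ ∑ a, p a * z' a < ∑ a, p a * z a := by
  have hc : Continuous fun t : ℝ => M.utilityExt i (t • z) :=
    (M.continuous_utilityExt i).comp (by fun_prop)
  have hev : ∀ᶠ t in nhds (1 : ℝ), v < M.utilityExt i (t • z) := by
    refine hc.continuousAt.eventually_const_lt ?_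
    simp only [one_smul]
    rwa [M.utilityExt_of_nonneg i hz]
  obtain ⟨t, ht, h0, h1⟩ := ((hev.filter_mono nhdsWithin_le_nhds).and
    (Ioo_mem_nhdsLT (zero_lt_one' ℝ))).exists
  have htz : 0 ≤ t • z := smul_nonneg h0.le hz
  refine ⟨t • z, htz, by rwa [M.utilityExt_of_nonneg i htz] at ht, ?_⟩
  have : ∑ a, p a * (t • z) a = t * ∑ a, p a * z a := by
    rw [Finset.mul_sum]
    exact Finset.sum_congr rfl fun a _ => by simp only [Pi.smul_apply, smul_eq_mul]; ring
  rw [this]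
  nlinarith

end Utility

/-! ### Sales, profits and earnings -/

section Sales

variable {A C J : Type*} {S : J → Type*} [Fintype A] [Fintype C] [Fintype J]
  [∀ j, Fintype (S j)]

omit [Fintype A] [Fintype C] [Fintype J] [∀ j, Fintype (S j)] in
theorem available_nonneg {y : A → C ⊕ J → ℝ} (hy : 0 ≤ y) (j : J) (k : S j ⊕ A) :
    0 ≤ available y j k := by
  rcases k with k | k
  · exact zero_le_one
  · exact hy k (Sum.inr j)

omit [Fintype C] [Fintype J] in
theorem sum_detailed (M : MixedMarket A C J S) {y : A → C ⊕ J → ℝ} (hy : 0 ≤ y) (i : A) (j : J)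
    {q : ℝ} (hq : 0 ≤ q) :
    ∑ k : S j ⊕ A, M.detailed y i j q k = min q (∑ k : S j ⊕ A, available y j k) := by
  classical
  have := M.prefers_total i j
  -- In this order the smaller seller is the preferred one.
  let _ : LinearOrder (S j ⊕ A) := linearOrderOfSTO (M.prefers i j)
  rw [← sum_min_max_sub_sum_lt Finset.univ (available_nonneg hy j) hq]
  refine Finset.sum_congr rfl fun k _ => ?_
  unfold detailed availableAbove
  congr 3
  refine Finset.sum_congr rfl fun k' _ => ?_
  congr 1

omit [Fintype C] [Fintype J] in
theorem detailed_nonneg (M : MixedMarket A C J S) {y : A → C ⊕ J → ℝ} (hy : 0 ≤ y) (i : A) (j : J)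
    (q : ℝ) (k : S j ⊕ A) : 0 ≤ M.detailed y i j q k :=
  le_min (available_nonneg hy j k) (le_max_left _ _)

omit [Fintype C] [Fintype J] in
/-- An agent who takes everything gets all that each seller offers. -/
theorem detailed_of_total_le (M : MixedMarket A C J S) {y : A → C ⊕ J → ℝ} (hy : 0 ≤ y) (i : A)
    (j : J) {q : ℝ} (hq : ∑ k : S j ⊕ A, available y j k ≤ q) (k : S j ⊕ A) :
    M.detailed y i j q k = available y j k := by
  classical
  have := M.prefers_total i j
  refine min_eq_left (le_max_of_le_right ?_)
  have h1 : M.availableAbove y i j k + available y j k ≤ ∑ k : S j ⊕ A, available y j k := by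
    have h2 : available y j k = ∑ k' : S j ⊕ A, if k' = k then available y j k' else 0 := by
      simp
    rw [h2, availableAbove, ← Finset.sum_add_distrib]
    refine Finset.sum_le_sum fun k' _ => ?_
    by_cases hk : k' = k
    · subst hk
      simp [irrefl_of (M.prefers i j) k']
    · rw [if_neg hk, add_zero]
      split_ifs
      · exact le_rfl
      · exact available_nonneg hy j k'
  linarith

/-- The part of the earnings of agent `i` that comes from her production `y'`, if the demand for
songs is that of the coarse allocation `z`. -/
noncomputable def profit (M : MixedMarket A C J S) (p : C ⊕ J → ℝ) (z y : A → C ⊕ J → ℝ) (i : A)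
    (y' : C ⊕ J → ℝ) : ℝ :=
  ∑ c : C, p (Sum.inl c) * y' (Sum.inl c) +
  ∑ j : J, p (Sum.inr j) * ∑ b : A, min (y' (Sum.inr j))
    (max 0 (z b (Sum.inr j) - M.availableAbove y b j (Sum.inr i)))

theorem le_profit (M : MixedMarket A C J S) {p : C ⊕ J → ℝ} (hp : 0 ≤ p) (z y : A → C ⊕ J → ℝ)
    (i : A) {y' : C ⊕ J → ℝ} (hy' : 0 ≤ y') :
    ∑ c : C, p (Sum.inl c) * y' (Sum.inl c) ≤ M.profit p z y i y' :=
  le_add_of_nonneg_right <| Finset.sum_nonneg fun _ _ => mul_nonneg (hp _) <|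
    Finset.sum_nonneg fun _ _ => le_min (hy' _) (le_max_left _ _)

/-- What is left for the seller is a constant `m` with respect to her own output, and `min · m` is
concave. Hence optimal productions form a convex set. -/
theorem profit_concave (M : MixedMarket A C J S) {p : C ⊕ J → ℝ} (hp : 0 ≤ p)
    (z y : A → C ⊕ J → ℝ) (i : A) : ConcaveOn ℝ Set.univ (M.profit p z y i) := by
  refine ⟨convex_univ, fun y₁ _ y₂ _ a b ha hb hab => ?_⟩
  unfold profit
  simp only [smul_eq_mul, Pi.add_apply, Pi.smul_apply, mul_add, Finset.mul_sum]
  rw [add_add_add_comm, ← Finset.sum_add_distrib, ← Finset.sum_add_distrib]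
  refine add_le_add (Finset.sum_le_sum fun c _ => le_of_eq (by ring))
    (Finset.sum_le_sum fun j _ => ?_)
  rw [← Finset.sum_add_distrib]
  refine Finset.sum_le_sum fun c _ => ?_
  set m := max 0 (z c (Sum.inr j) - M.availableAbove y c j (Sum.inr i))
  have h1 : a * min (y₁ (Sum.inr j)) m + b * min (y₂ (Sum.inr j)) m ≤
      min (a * y₁ (Sum.inr j) + b * y₂ (Sum.inr j)) m := by
    refine le_min (add_le_add (mul_le_mul_of_nonneg_left (min_le_left _ _) ha)
      (mul_le_mul_of_nonneg_left (min_le_left _ _) hb)) ?_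
    calc _ ≤ a * m + b * m := add_le_add (mul_le_mul_of_nonneg_left (min_le_right _ _) ha)
          (mul_le_mul_of_nonneg_left (min_le_right _ _) hb)
      _ = m := by rw [← add_mul, hab, one_mul]
  calc _ = p (Sum.inr j) * (a * min (y₁ (Sum.inr j)) m + b * min (y₂ (Sum.inr j)) m) := by ring
    _ ≤ _ := mul_le_mul_of_nonneg_left h1 (hp _)

/-- All that is produced or initially present is worth what its buyers pay for it. -/
theorem sum_profit (M : MixedMarket A C J S) (p : C ⊕ J → ℝ) {z y : A → C ⊕ J → ℝ}
    (hz : 0 ≤ z) (hy : 0 ≤ y) :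
    ∑ i, M.profit p z y i (y i) + ∑ j : J, p (Sum.inr j) * ∑ b, ∑ s : S j,
        M.detailed y b j (z b (Sum.inr j)) (Sum.inl s) =
      ∑ c : C, p (Sum.inl c) * ∑ i, y i (Sum.inl c) +
        ∑ j : J, p (Sum.inr j) * ∑ b, min (z b (Sum.inr j)) (∑ k : S j ⊕ A, available y j k) := by
  have h1 : ∀ j : J, ∑ b, min (z b (Sum.inr j)) (∑ k : S j ⊕ A, available y j k) =
      ∑ b, ∑ s : S j, M.detailed y b j (z b (Sum.inr j)) (Sum.inl s) +
        ∑ b, ∑ i : A, M.detailed y b j (z b (Sum.inr j)) (Sum.inr i) := by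
    intro j
    rw [← Finset.sum_add_distrib]
    refine Finset.sum_congr rfl fun b _ => ?_
    rw [← M.sum_detailed hy b j (hz b _), Fintype.sum_sum_type]
  simp only [h1, profit, mul_add, Finset.sum_add_distrib]
  rw [Finset.sum_comm, add_assoc]
  congr 1
  · exact Finset.sum_congr rfl fun c _ => by rw [Finset.mul_sum]
  · rw [add_comm]
    congr 1
    rw [Finset.sum_comm]
    refine Finset.sum_congr rfl fun j _ => ?_
    rw [← Finset.mul_sum, Finset.sum_comm]
    rfl

theorem sum_profit_le (M : MixedMarket A C J S) {p : C ⊕ J → ℝ} (hp : 0 ≤ p)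
    {z y : A → C ⊕ J → ℝ} (hz : 0 ≤ z) (hy : 0 ≤ y) :
    ∑ i, M.profit p z y i (y i) ≤ ∑ c : C, p (Sum.inl c) * ∑ i, y i (Sum.inl c) +
      ∑ j : J, p (Sum.inr j) * ∑ b, min (z b (Sum.inr j)) (∑ k : S j ⊕ A, available y j k) := by
  rw [← M.sum_profit p hz hy]
  exact le_add_of_nonneg_right <| Finset.sum_nonneg fun j _ => mul_nonneg (hp _) <|
    Finset.sum_nonneg fun b _ => Finset.sum_nonneg fun s _ => M.detailed_nonneg hy _ _ _ _

-- The sales of initial songs do not depend on `y'`, so maximizing earnings amounts to maximizing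
-- profit. The bound `hle` makes the detailed purchases add up to the coarse demand.
open Classical in
theorem earnings_eq (M : MixedMarket A C J S) (p : C ⊕ J → ℝ) {z y : A → C ⊕ J → ℝ}
    (hz : 0 ≤ z) (hy : 0 ≤ y)
    (hle : ∀ b (j : J), z b (Sum.inr j) ≤ ∑ k : S j ⊕ A, available y j k) (i : A)
    (y' : C ⊕ J → ℝ) :
    M.earnings p (fun b j k => M.detailed y b j (z b (Sum.inr j)) k) y i y' =
      M.profit p z y i y' + ∑ j : J, p (Sum.inr j) * ∑ b, ∑ s : S j,
        if M.owner j s = i then M.detailed y b j (z b (Sum.inr j)) (Sum.inl s) else 0 := by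
  unfold earnings profit
  rw [add_assoc, ← Finset.sum_add_distrib]
  congr 1
  refine Finset.sum_congr rfl fun j _ => ?_
  rw [← mul_add, ← Finset.sum_add_distrib]
  congr 1
  refine Finset.sum_congr rfl fun b _ => ?_
  rw [M.sum_detailed hy b j (hz b _), min_eq_left (hle b j), add_comm]

theorem sum_earnings (M : MixedMarket A C J S) (p : C ⊕ J → ℝ) {z y : A → C ⊕ J → ℝ}
    (hz : 0 ≤ z) (hy : 0 ≤ y)
    (hle : ∀ b (j : J), z b (Sum.inr j) ≤ ∑ k : S j ⊕ A, available y j k) :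
    ∑ i, M.earnings p (fun b j k => M.detailed y b j (z b (Sum.inr j)) k) y i (y i) =
      ∑ c : C, p (Sum.inl c) * ∑ i, y i (Sum.inl c) +
        ∑ j : J, p (Sum.inr j) * ∑ b, z b (Sum.inr j) := by
  classical
  have h := M.sum_profit p hz hy
  simp only [min_eq_left (hle _ _)] at h
  rw [← h]
  simp only [M.earnings_eq p hz hy hle, Finset.sum_add_distrib]
  congr 1
  rw [Finset.sum_comm]
  refine Finset.sum_congr rfl fun j _ => ?_
  rw [← Finset.mul_sum, Finset.sum_comm]
  congr 1
  refine Finset.sum_congr rfl fun b _ => ?_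
  rw [Finset.sum_comm]
  exact Finset.sum_congr rfl fun s _ => by simp

omit [Fintype A] [Fintype C] [Fintype J] [∀ j, Fintype (S j)] in
theorem continuous_available (j : J) (k : S j ⊕ A) :
    Continuous fun y : A → C ⊕ J → ℝ => available y j k := by
  rcases k with k | k
  · exact continuous_const
  · exact (continuous_apply _).comp (continuous_apply k)

omit [Fintype C] [Fintype J] in
theorem continuous_availableAbove (M : MixedMarket A C J S) (i : A) (j : J) (k : S j ⊕ A) :
    Continuous fun y : A → C ⊕ J → ℝ => M.availableAbove y i j k := by
  unfold availableAbove
  refine continuous_finsetSum _ fun k' _ => ?_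
  split_ifs
  · exact continuous_available j k'
  · exact continuous_const

theorem continuous_profit {X : Type*} [TopologicalSpace X] (M : MixedMarket A C J S) (i : A)
    {p y' : X → C ⊕ J → ℝ} {z y : X → A → C ⊕ J → ℝ} (hp : Continuous p) (hz : Continuous z)
    (hy : Continuous y) (hy' : Continuous y') :
    Continuous fun x => M.profit (p x) (z x) (y x) i (y' x) := by
  have h : ∀ b j, Continuous fun x => M.availableAbove (y x) b j (Sum.inr i) :=
    fun b j => (M.continuous_availableAbove b j (Sum.inr i)).comp hy
  unfold profit
  fun_prop

end Sales

end MixedMarket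

namespace MixedMarket

/-! ### Compensated equilibria and compensated demand -/

section QuasiEquilibrium

variable {A C J : Type*} {S : J → Type*} [Fintype A] [Fintype C] [Fintype J]
  [∀ j, Fintype (S j)] [Nonempty A]

/-- Excess demand; for a digital category, the excess of the largest demand over what there is. -/
noncomputable def excess (_ : MixedMarket A C J S) (z y : A → C ⊕ J → ℝ) : C ⊕ J → ℝ
  | Sum.inl c => ∑ i, z i (Sum.inl c) - ∑ i, y i (Sum.inl c)
  | Sum.inr j => Finset.univ.sup' Finset.univ_nonempty (fun i => z i (Sum.inr j)) -
      ∑ k : S j ⊕ A, available y j k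

omit [Fintype C] [Fintype J] in
theorem continuous_excess {X : Type*} [TopologicalSpace X] (M : MixedMarket A C J S)
    {z y : X → A → C ⊕ J → ℝ} (hz : Continuous z) (hy : Continuous y) (a : C ⊕ J) :
    Continuous fun x => M.excess (z x) (y x) a := by
  rcases a with c | j
  · simp only [excess]
    fun_prop
  · have h : ∀ k : S j ⊕ A, Continuous fun x => available (y x) j k :=
      fun k => (continuous_available j k).comp hy
    simp only [excess]
    refine Continuous.sub (Continuous.finset_sup'_apply _ fun i _ => ?_)
      (continuous_finsetSum _ fun k _ => h k)
    fun_prop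

omit [Fintype C] [Fintype J] in
theorem le_of_excess_nonpos (M : MixedMarket A C J S) {K : ℝ}
    (hK : ∀ y : A → C ⊕ J → ℝ, (∀ i, y i ∈ M.production i) →
      (∀ c : C, ∑ i, y i (Sum.inl c) ≤ K) ∧ ∀ j : J, ∑ k : S j ⊕ A, available y j k ≤ K)
    {z y : A → C ⊕ J → ℝ} (hz : 0 ≤ z) (hy : ∀ i, y i ∈ M.production i)
    (h : ∀ a, M.excess z y a ≤ 0) (i : A) : z i ≤ fun _ => K := by
  intro a
  rcases a with c | j
  · have h1 : z i (Sum.inl c) ≤ ∑ i, z i (Sum.inl c) :=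
      Finset.single_le_sum (f := fun i => z i (Sum.inl c)) (fun i _ => hz i _) (Finset.mem_univ i)
    have h2 := h (Sum.inl c)
    simp only [excess] at h2
    linarith [(hK y hy).1 c]
  · have h1 := Finset.le_sup' (fun i => z i (Sum.inr j)) (Finset.mem_univ i)
    have h2 := h (Sum.inr j)
    simp only [excess] at h2
    linarith [(hK y hy).2 j]

/-- Prices, a utility scale, a coarse allocation and a production. -/
abbrev State (A C J : Type*) :=
  (C ⊕ J → ℝ) × ℝ × (A → C ⊕ J → ℝ) × (A → C ⊕ J → ℝ)

/-- A compensated equilibrium at the utilities `α • u`: every bundle below `R` that is better than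
`α * u i` costs at least as much as `z i`. -/
structure IsQuasiEquilibrium (M : MixedMarket A C J S) (u : A → ℝ) (R : ℝ) (p : C ⊕ J → ℝ) (α : ℝ)
    (z y : A → C ⊕ J → ℝ) : Prop where
  price_mem : p ∈ stdSimplex ℝ (C ⊕ J)
  scale_nonneg : 0 ≤ α
  production_mem : ∀ i, y i ∈ M.production i
  production_optimal : ∀ i, ∀ y' ∈ M.production i, M.profit p z y i y' ≤ M.profit p z y i (y i)
  excess_nonpos : ∀ a, M.excess z y a ≤ 0
  value_excess : ∑ a, p a * M.excess z y a = 0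
  allocation_nonneg : 0 ≤ z
  le_utility : ∀ i, α * u i ≤ M.utilityExt i (z i)
  cheapest : ∀ i, ∀ z' ∈ Set.Icc (0 : C ⊕ J → ℝ) (fun _ => R), α * u i < M.utilityExt i z' →
    ∑ a, p a * z i a ≤ ∑ a, p a * z' a
  eq_zero : ∀ i, u i = 0 → z i = 0

-- Comparing only with strictly better bundles gives an implication from an open condition to a
-- closed one, which is a closed condition.
omit [Fintype A] [∀ j, Fintype (S j)] [Nonempty A] in
theorem isClosed_cheapest {X : Type*} [TopologicalSpace X] (M : MixedMarket A C J S) (i : A)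
    (B : Set (C ⊕ J → ℝ)) {v : X → ℝ} {p z : X → C ⊕ J → ℝ} (hv : Continuous v)
    (hp : Continuous p) (hz : Continuous z) :
    IsClosed {x | ∀ z' ∈ B, v x < M.utilityExt i z' → ∑ a, p x a * z x a ≤ ∑ a, p x a * z' a} := by
  simp only [Set.ofPred_forall]
  refine isClosed_iInter fun z' => isClosed_iInter fun _ => ?_
  exact isClosed_imp (isOpen_lt hv continuous_const) (isClosed_le (by fun_prop) (by fun_prop))

omit [Nonempty A] in
theorem isClosed_production_optimal {X : Type*} [TopologicalSpace X] (M : MixedMarket A C J S)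
    (i : A) (P : Set (C ⊕ J → ℝ)) {p y' : X → C ⊕ J → ℝ} {z y : X → A → C ⊕ J → ℝ}
    (hp : Continuous p) (hz : Continuous z) (hy : Continuous y) (hy' : Continuous y') :
    IsClosed {x | ∀ y'' ∈ P, M.profit (p x) (z x) (y x) i y'' ≤
      M.profit (p x) (z x) (y x) i (y' x)} := by
  simp only [Set.ofPred_forall]
  refine isClosed_iInter fun y'' => isClosed_iInter fun _ => ?_
  exact isClosed_le (M.continuous_profit i hp hz hy continuous_const)
    (M.continuous_profit i hp hz hy hy')

theorem isClosed_setOf_isQuasiEquilibrium (M : MixedMarket A C J S) (u : A → ℝ) (R : ℝ) :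
    IsClosed {q : State A C J | M.IsQuasiEquilibrium u R q.1 q.2.1 q.2.2.1 q.2.2.2} := by
  have hex : ∀ a, Continuous fun q : State A C J => M.excess q.2.2.1 q.2.2.2 a :=
    M.continuous_excess (by fun_prop) (by fun_prop)
  have h : {q : State A C J | M.IsQuasiEquilibrium u R q.1 q.2.1 q.2.2.1 q.2.2.2} =
      {q | q.1 ∈ stdSimplex ℝ (C ⊕ J)} ∩ {q | 0 ≤ q.2.1} ∩
      (⋂ i, {q | q.2.2.2 i ∈ M.production i}) ∩
      (⋂ i, {q | ∀ y' ∈ M.production i, M.profit q.1 q.2.2.1 q.2.2.2 i y' ≤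
        M.profit q.1 q.2.2.1 q.2.2.2 i (q.2.2.2 i)}) ∩
      (⋂ a, {q | M.excess q.2.2.1 q.2.2.2 a ≤ 0}) ∩
      {q | ∑ a, q.1 a * M.excess q.2.2.1 q.2.2.2 a = 0} ∩ {q | 0 ≤ q.2.2.1} ∩
      (⋂ i, {q | q.2.1 * u i ≤ M.utilityExt i (q.2.2.1 i)}) ∩
      (⋂ i, {q | ∀ z' ∈ Set.Icc (0 : C ⊕ J → ℝ) (fun _ => R), q.2.1 * u i < M.utilityExt i z' →
        ∑ a, q.1 a * q.2.2.1 i a ≤ ∑ a, q.1 a * z' a}) ∩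
      (⋂ i, {q | u i = 0 → q.2.2.1 i = 0}) := by
    ext q
    simp only [Set.mem_inter_iff, Set.mem_iInter, Set.mem_ofPred_eq]
    constructor
    · rintro ⟨h1, h2, h3, h4, h5, h6, h7, h8, h9, h10⟩
      exact ⟨⟨⟨⟨⟨⟨⟨⟨⟨h1, h2⟩, h3⟩, h4⟩, h5⟩, h6⟩, h7⟩, h8⟩, h9⟩, h10⟩
    · rintro ⟨⟨⟨⟨⟨⟨⟨⟨⟨h1, h2⟩, h3⟩, h4⟩, h5⟩, h6⟩, h7⟩, h8⟩, h9⟩, h10⟩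
      exact ⟨h1, h2, h3, h4, h5, h6, h7, h8, h9, h10⟩
  rw [h]
  refine IsClosed.inter (IsClosed.inter (IsClosed.inter (IsClosed.inter (IsClosed.inter
    (IsClosed.inter (IsClosed.inter (IsClosed.inter (IsClosed.inter ?_ ?_) ?_) ?_) ?_) ?_) ?_) ?_)
    ?_) ?_
  · exact (isClosed_stdSimplex ℝ (C ⊕ J)).preimage continuous_fst
  · exact isClosed_le continuous_const (by fun_prop)
  · exact isClosed_iInter fun i => (M.production_compact i).isClosed.preimage (by fun_prop)
  · exact isClosed_iInter fun i => M.isClosed_production_optimal i _ (by fun_prop) (by fun_prop)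
      (by fun_prop) (by fun_prop)
  · exact isClosed_iInter fun a => isClosed_le (hex a) continuous_const
  · exact isClosed_eq (continuous_finsetSum _ fun a _ => Continuous.mul (by fun_prop) (hex a))
      continuous_const
  · exact isClosed_le continuous_const (by fun_prop)
  · exact isClosed_iInter fun i => isClosed_le (by fun_prop)
      ((M.continuous_utilityExt i).comp (by fun_prop))
  · exact isClosed_iInter fun i => M.isClosed_cheapest i _ (by fun_prop) (by fun_prop)
      (by fun_prop)
  · exact isClosed_iInter fun i => isClosed_imp isOpen_const
      (isClosed_eq (by fun_prop) continuous_const)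

/-- The bundles below `R` with utility at least `v` that cost no more than any bundle with utility
above `v`. -/
def compensatedDemand (M : MixedMarket A C J S) (R : ℝ) (i : A) (p : C ⊕ J → ℝ) (v : ℝ) :
    Set (C ⊕ J → ℝ) :=
  {z | z ∈ Set.Icc (0 : C ⊕ J → ℝ) (fun _ => R) ∧ v ≤ M.utilityExt i z ∧
    ∀ z' ∈ Set.Icc (0 : C ⊕ J → ℝ) (fun _ => R), v < M.utilityExt i z' →
      ∑ a, p a * z a ≤ ∑ a, p a * z' a}

omit [Fintype A] [∀ j, Fintype (S j)] [Nonempty A] in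
theorem convex_compensatedDemand (M : MixedMarket A C J S) (R : ℝ) (i : A) (p : C ⊕ J → ℝ)
    (v : ℝ) : Convex ℝ (M.compensatedDemand R i p v) := by
  rintro z₁ ⟨h1, h2, h3⟩ z₂ ⟨h1', h2', h3'⟩ a b ha hb hab
  have hI := convex_Icc (0 : C ⊕ J → ℝ) (fun _ => R) h1 h1' ha hb hab
  rw [M.utilityExt_of_nonneg i h1.1] at h2
  rw [M.utilityExt_of_nonneg i h1'.1] at h2'
  refine ⟨hI, ?_, fun z' hz' hv => ?_⟩
  · rw [M.utilityExt_of_nonneg i hI.1]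
    exact (M.utility_quasiconcave i v ⟨h1.1, h2⟩ ⟨h1'.1, h2'⟩ ha hb hab).2
  · have e : ∑ c, p c * (a • z₁ + b • z₂) c = a * ∑ c, p c * z₁ c + b * ∑ c, p c * z₂ c := by
      rw [Finset.mul_sum, Finset.mul_sum, ← Finset.sum_add_distrib]
      exact Finset.sum_congr rfl fun c _ => by
        simp only [Pi.add_apply, Pi.smul_apply, smul_eq_mul]; ring
    rw [e]
    calc _ ≤ a * (∑ c, p c * z' c) + b * ∑ c, p c * z' c :=
          add_le_add (mul_le_mul_of_nonneg_left (h3 z' hz' hv) ha)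
            (mul_le_mul_of_nonneg_left (h3' z' hz' hv) hb)
      _ = _ := by rw [← add_mul, hab, one_mul]

-- A least cost over the strictly better bundles need not be attained, so it is taken over their
-- closure, where the utility is still at least `v`. If there are no better bundles, the top corner
-- of the box serves.
omit [Fintype A] [∀ j, Fintype (S j)] [Nonempty A] in
theorem compensatedDemand_nonempty (M : MixedMarket A C J S) {R : ℝ} (hR : 0 ≤ R) (i : A)
    (p : C ⊕ J → ℝ) {v : ℝ} (hv : v ≤ M.utilityExt i fun _ => R) :
    (M.compensatedDemand R i p v).Nonempty := by
  have hRm : (fun _ => R) ∈ Set.Icc (0 : C ⊕ J → ℝ) (fun _ => R) := ⟨fun _ => hR, le_rfl⟩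
  set B := {z | z ∈ Set.Icc (0 : C ⊕ J → ℝ) (fun _ => R) ∧ v < M.utilityExt i z}
  rcases B.eq_empty_or_nonempty with hB | hB
  · refine ⟨fun _ => R, hRm, hv, fun z' hz' hlt => ?_⟩
    have : z' ∈ B := ⟨hz', hlt⟩
    rw [hB] at this
    exact this.elim
  · have hcl : closure B ⊆ {z | z ∈ Set.Icc (0 : C ⊕ J → ℝ) (fun _ => R) ∧
        v ≤ M.utilityExt i z} :=
      closure_minimal (fun z hz => ⟨hz.1, hz.2.le⟩)
        (isClosed_Icc.inter (isClosed_le continuous_const (M.continuous_utilityExt i)))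
    have hcomp : IsCompact (closure B) :=
      isCompact_Icc.of_isClosed_subset isClosed_closure fun z hz => (hcl hz).1
    obtain ⟨z, hz, hmin⟩ := hcomp.exists_isMinOn hB.closure
      (f := fun z => ∑ a, p a * z a) (by fun_prop)
    exact ⟨z, (hcl hz).1, (hcl hz).2, fun z' hz' hlt => hmin (subset_closure ⟨hz', hlt⟩)⟩

end QuasiEquilibrium

end MixedMarket

namespace MixedMarket

/-! ### The reaction correspondence -/

section Existence

theorem isClosed_setOf_forall {X : Type*} {ι : Sort*} [TopologicalSpace X] {s : ι → X → Prop}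
    (h : ∀ i, IsClosed {x | s i x}) : IsClosed {x | ∀ i, s i x} := by
  rw [Set.ofPred_forall]
  exact isClosed_iInter h

variable {A C J : Type*} {S : J → Type*} [Fintype A] [Fintype C] [Fintype J]
  [∀ j, Fintype (S j)] [Nonempty A]

/-- The state space for the fixed point argument. -/
def feasibleStates (M : MixedMarket A C J S) (αmax R : ℝ) : Set (State A C J) :=
  stdSimplex ℝ (C ⊕ J) ×ˢ Set.Icc 0 αmax ×ˢ
    (Set.univ.pi fun _ : A => Set.Icc (0 : C ⊕ J → ℝ) (fun _ => R)) ×ˢ Set.univ.pi M.production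

omit [Fintype A] [∀ j, Fintype (S j)] [Nonempty A] in
theorem isCompact_feasibleStates (M : MixedMarket A C J S) (αmax R : ℝ) :
    IsCompact (M.feasibleStates αmax R) :=
  (isCompact_stdSimplex ℝ _).prod (isCompact_Icc.prod
    ((isCompact_univ_pi fun _ => isCompact_Icc).prod (isCompact_univ_pi M.production_compact)))

/-- Prices maximize the value of excess demand, the utility scale minimizes it, consumers choose
compensated demands, and producers respond optimally. -/
def reactions (M : MixedMarket A C J S) (u : A → ℝ) (αmax R : ℝ) (q : State A C J) :
    Set (State A C J) :=
  {p | p ∈ stdSimplex ℝ (C ⊕ J) ∧ ∀ p' ∈ stdSimplex ℝ (C ⊕ J),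
      ∑ a, p' a * M.excess q.2.2.1 q.2.2.2 a ≤ ∑ a, p a * M.excess q.2.2.1 q.2.2.2 a} ×ˢ
  {α | α ∈ Set.Icc 0 αmax ∧ ∀ α' ∈ Set.Icc 0 αmax,
      α * ∑ a, q.1 a * M.excess q.2.2.1 q.2.2.2 a ≤
        α' * ∑ a, q.1 a * M.excess q.2.2.1 q.2.2.2 a} ×ˢ
  (Set.univ.pi fun i => M.compensatedDemand R i q.1
      (min (q.2.1 * u i) (M.utilityExt i fun _ => R)) ∩ {z | u i = 0 → z = 0}) ×ˢ
  (Set.univ.pi fun i => {y | y ∈ M.production i ∧ ∀ y' ∈ M.production i,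
      M.profit q.1 q.2.2.1 q.2.2.2 i y' ≤ M.profit q.1 q.2.2.1 q.2.2.2 i y})

theorem reactions_subset (M : MixedMarket A C J S) (u : A → ℝ) (αmax R : ℝ) (q : State A C J) :
    M.reactions u αmax R q ⊆ M.feasibleStates αmax R :=
  Set.prod_mono (fun _ h => h.1) <| Set.prod_mono (fun _ h => h.1) <|
    Set.prod_mono (Set.pi_mono fun _ _ _ h => h.1.1) (Set.pi_mono fun _ _ _ h => h.1)

theorem convex_reactions (M : MixedMarket A C J S) (u : A → ℝ) (αmax R : ℝ) {q : State A C J}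
    (hp : 0 ≤ q.1) : Convex ℝ (M.reactions u αmax R q) := by
  refine Convex.prod ?_ (Convex.prod ?_ (Convex.prod ?_ ?_))
  · rintro p ⟨h1, h2⟩ p' ⟨h1', h2'⟩ a b ha hb hab
    refine ⟨convex_stdSimplex ℝ _ h1 h1' ha hb hab, fun p'' hp'' => ?_⟩
    have e : ∑ c, (a • p + b • p') c * M.excess q.2.2.1 q.2.2.2 c =
        a * ∑ c, p c * M.excess q.2.2.1 q.2.2.2 c +
          b * ∑ c, p' c * M.excess q.2.2.1 q.2.2.2 c := by
      rw [Finset.mul_sum, Finset.mul_sum, ← Finset.sum_add_distrib]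
      exact Finset.sum_congr rfl fun c _ => by
        simp only [Pi.add_apply, Pi.smul_apply, smul_eq_mul]; ring
    rw [e]
    calc _ = a * (∑ c, p'' c * M.excess q.2.2.1 q.2.2.2 c) +
          b * ∑ c, p'' c * M.excess q.2.2.1 q.2.2.2 c := by rw [← add_mul, hab, one_mul]
      _ ≤ _ := add_le_add (mul_le_mul_of_nonneg_left (h2 p'' hp'') ha)
          (mul_le_mul_of_nonneg_left (h2' p'' hp'') hb)
  · rintro x ⟨h1, h2⟩ x' ⟨h1', h2'⟩ a b ha hb hab
    refine ⟨convex_Icc _ _ h1 h1' ha hb hab, fun x'' hx'' => ?_⟩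
    set V := ∑ c, q.1 c * M.excess q.2.2.1 q.2.2.2 c
    calc (a • x + b • x') * V = a * (x * V) + b * (x' * V) := by simp only [smul_eq_mul]; ring
      _ ≤ a * (x'' * V) + b * (x'' * V) := add_le_add (mul_le_mul_of_nonneg_left (h2 x'' hx'') ha)
          (mul_le_mul_of_nonneg_left (h2' x'' hx'') hb)
      _ = x'' * V := by rw [← add_mul, hab, one_mul]
  · refine convex_pi fun i _ => (M.convex_compensatedDemand R i _ _).inter ?_
    intro z hz z' hz' a b _ _ _ h
    rw [hz h, hz' h, smul_zero, smul_zero, add_zero]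
  · refine convex_pi fun i _ => ?_
    intro y hy y' hy' a b ha hb hab
    refine ⟨M.production_convex i hy.1 hy'.1 ha hb hab, fun y'' hy'' => ?_⟩
    refine le_trans ?_ ((M.profit_concave hp _ _ i).2 (Set.mem_univ _) (Set.mem_univ _) ha hb hab)
    calc _ = a * M.profit q.1 q.2.2.1 q.2.2.2 i y'' + b * M.profit q.1 q.2.2.1 q.2.2.2 i y'' := by
          rw [← add_mul, hab, one_mul]
      _ ≤ _ := add_le_add (mul_le_mul_of_nonneg_left (hy.2 y'' hy'') ha)
          (mul_le_mul_of_nonneg_left (hy'.2 y'' hy'') hb)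

theorem reactions_nonempty [Nonempty (C ⊕ J)] (M : MixedMarket A C J S) (u : A → ℝ)
    {αmax R : ℝ} (hα : 0 ≤ αmax) (hR : 0 ≤ R) (hP : ∀ i, (M.production i).Nonempty)
    {q : State A C J} (hp : 0 ≤ q.1) : (M.reactions u αmax R q).Nonempty := by
  classical
  refine Set.Nonempty.prod ?_ (Set.Nonempty.prod ?_ (Set.Nonempty.prod ?_ ?_))
  · obtain ⟨p, hp, hmax⟩ := (isCompact_stdSimplex ℝ (C ⊕ J)).exists_isMaxOn
      ⟨_, single_mem_stdSimplex ℝ (Classical.arbitrary (C ⊕ J))⟩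
      (f := fun p => ∑ a, p a * M.excess q.2.2.1 q.2.2.2 a) (by fun_prop)
    exact ⟨p, hp, fun p' hp' => hmax hp'⟩
  · obtain ⟨x, hx, hmin⟩ := (isCompact_Icc (a := (0 : ℝ)) (b := αmax)).exists_isMinOn
      ⟨0, le_rfl, hα⟩ (f := fun x => x * ∑ a, q.1 a * M.excess q.2.2.1 q.2.2.2 a) (by fun_prop)
    exact ⟨x, hx, fun x' hx' => hmin hx'⟩
  · refine Set.univ_pi_nonempty_iff.2 fun i => ?_
    by_cases hi : u i = 0
    · refine ⟨0, ⟨⟨⟨le_rfl, fun _ => hR⟩, ?_, fun z' hz' _ => ?_⟩, fun _ => rfl⟩⟩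
      · rw [hi, mul_zero]
        exact (min_le_left _ _).trans (M.utility_nonneg i _ (le_sup_right))
      · simp only [Pi.zero_apply, mul_zero, Finset.sum_const_zero]
        exact Finset.sum_nonneg fun a _ => mul_nonneg (hp a) (hz'.1 a)
    · obtain ⟨z, hz⟩ := M.compensatedDemand_nonempty hR i q.1
        (v := min (q.2.1 * u i) (M.utilityExt i fun _ => R)) (min_le_right _ _)
      exact ⟨z, hz, fun h => absurd h hi⟩
  · refine Set.univ_pi_nonempty_iff.2 fun i => ?_
    obtain ⟨y, hy, hmax⟩ := (M.production_compact i).exists_isMaxOn (hP i)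
      (f := M.profit q.1 q.2.2.1 q.2.2.2 i)
      (M.continuous_profit i continuous_const continuous_const continuous_const
        continuous_id).continuousOn
    exact ⟨y, hy, fun y' hy' => hmax hy'⟩

theorem isClosed_graph_reactions (M : MixedMarket A C J S) (u : A → ℝ) (αmax R : ℝ) :
    IsClosed {q : State A C J × State A C J | q.2 ∈ M.reactions u αmax R q.1} := by
  have hex : ∀ a, Continuous fun q : State A C J × State A C J =>
      M.excess q.1.2.2.1 q.1.2.2.2 a := M.continuous_excess (by fun_prop) (by fun_prop)
  have hv : ∀ i, Continuous fun q : State A C J × State A C J =>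
      min (q.1.2.1 * u i) (M.utilityExt i fun _ => R) := fun i => by fun_prop
  simp only [reactions, compensatedDemand, Set.mem_prod, Set.mem_pi, Set.mem_univ, true_implies,
    Set.mem_inter_iff, Set.mem_ofPred_eq]
  refine IsClosed.and (IsClosed.and ?_ (isClosed_setOf_forall fun p' => isClosed_setOf_forall fun _ => ?_))
    (IsClosed.and (IsClosed.and ?_ (isClosed_setOf_forall fun p' => isClosed_setOf_forall fun _ => ?_))
    (IsClosed.and (isClosed_setOf_forall fun i => IsClosed.and (IsClosed.and ?_ (IsClosed.and ?_ ?_)) ?_) (isClosed_setOf_forall fun i => IsClosed.and ?_ ?_)))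
  · exact (isClosed_stdSimplex ℝ (C ⊕ J)).preimage (by fun_prop)
  · exact isClosed_le (continuous_finsetSum _ fun a _ => Continuous.mul (by fun_prop) (hex a))
      (continuous_finsetSum _ fun a _ => Continuous.mul (by fun_prop) (hex a))
  · exact isClosed_Icc.preimage (by fun_prop)
  · exact isClosed_le (Continuous.mul (by fun_prop)
        (continuous_finsetSum _ fun a _ => Continuous.mul (by fun_prop) (hex a)))
      (Continuous.mul (by fun_prop)
        (continuous_finsetSum _ fun a _ => Continuous.mul (by fun_prop) (hex a)))
  · exact isClosed_Icc.preimage (by fun_prop)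
  · exact isClosed_le (hv i) ((M.continuous_utilityExt i).comp (by fun_prop))
  · exact M.isClosed_cheapest i _ (hv i) (by fun_prop) (by fun_prop)
  · exact isClosed_imp isOpen_const (isClosed_eq (by fun_prop) continuous_const)
  · exact (M.production_compact i).isClosed.preimage (by fun_prop)
  · exact M.isClosed_production_optimal i _ (by fun_prop) (by fun_prop) (by fun_prop)
      (by fun_prop)

end Existence

end MixedMarket

namespace MixedMarket

/-! ### Existence of a compensated equilibrium -/

section Welfare

variable {A C J : Type*} {S : J → Type*} [Fintype A] [Fintype C] [Fintype J]
  [∀ j, Fintype (S j)]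

theorem exists_production_bound (M : MixedMarket A C J S) : ∃ K : ℝ, 0 ≤ K ∧
    ∀ y : A → C ⊕ J → ℝ, (∀ i, y i ∈ M.production i) →
      (∀ c : C, ∑ i, y i (Sum.inl c) ≤ K) ∧ ∀ j : J, ∑ k : S j ⊕ A, available y j k ≤ K := by
  have h : ∀ i, ∃ b : ℝ, ∀ y ∈ M.production i, ∀ a, y a ≤ b := by
    intro i
    obtain ⟨b, hb⟩ := (M.production_compact i).isBounded.subset_closedBall 0
    refine ⟨b, fun y hy a => ?_⟩
    have h1 := hb hy
    rw [mem_closedBall_zero_iff] at h1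
    exact (le_abs_self _).trans ((norm_le_pi_norm y a).trans h1)
  choose b hb using h
  refine ⟨∑ i, |b i| + ∑ j, (Fintype.card (S j) : ℝ), by positivity, fun y hy => ?_⟩
  have hyb : ∀ a, ∑ i, y i a ≤ ∑ i, |b i| := fun a =>
    Finset.sum_le_sum fun i _ => (hb i (y i) (hy i) a).trans (le_abs_self _)
  constructor
  · intro c
    exact (hyb _).trans (le_add_of_nonneg_right (by positivity))
  · intro j
    rw [Fintype.sum_sum_type, add_comm]
    refine add_le_add (hyb _) ?_
    simp only [available, Finset.sum_const, Finset.card_univ, nsmul_eq_mul, mul_one]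
    exact Finset.single_le_sum (f := fun j => (Fintype.card (S j) : ℝ))
      (fun _ _ => by positivity) (Finset.mem_univ j)

-- The strict gain in utility keeps bundles within the production bound `K` from reaching the
-- utility of the corner `R`, so the truncation at `R` does not bind.
omit [∀ j, Fintype (S j)] in
theorem exists_larger_box (M : MixedMarket A C J S) [Nonempty (C ⊕ J)] (K : ℝ) (hK : 0 ≤ K) :
    ∃ R, K ≤ R ∧ ∀ i, M.utility i (fun _ => K) < M.utility i fun _ => R := by
  have hK' : (0 : C ⊕ J → ℝ) ≤ fun _ => K := fun _ => hK
  have h := fun i => M.utility_nonsatiated i (fun _ => K) hK' (Classical.arbitrary (C ⊕ J))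
  choose z hoff hlt hU using h
  have hz : ∀ i a, K ≤ z i a := by
    intro i a
    by_cases ha : a = Classical.arbitrary (C ⊕ J)
    · exact ha ▸ (hlt i).le
    · exact (hoff i a ha).ge
  refine ⟨K + ∑ i, ∑ a, (z i a - K), le_add_of_nonneg_right (Finset.sum_nonneg fun i _ =>
    Finset.sum_nonneg fun a _ => sub_nonneg.2 (hz i a)), fun i => (hU i).trans_le ?_⟩
  refine M.utility_mono i (fun a => hK.trans (hz i a)) fun a => ?_
  have h1 : z i a - K ≤ ∑ a, (z i a - K) :=
    Finset.single_le_sum (f := fun a => z i a - K) (fun a _ => sub_nonneg.2 (hz i a))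
      (Finset.mem_univ a)
  have h2 : ∑ a, (z i a - K) ≤ ∑ i, ∑ a, (z i a - K) :=
    Finset.single_le_sum (f := fun i => ∑ a, (z i a - K))
      (fun i _ => Finset.sum_nonneg fun a _ => sub_nonneg.2 (hz i a)) (Finset.mem_univ i)
  linarith

/-- A conventional allocation is worth no more than the earnings from optimal production. -/
theorem value_conventional_le (M : MixedMarket A C J S) {p : C ⊕ J → ℝ} (hp : 0 ≤ p)
    {z y y₀ z₀ : A → C ⊕ J → ℝ} (hz : 0 ≤ z) (hy : ∀ i, y i ∈ M.production i)
    (hopt : ∀ i, ∀ y' ∈ M.production i, M.profit p z y i y' ≤ M.profit p z y i (y i))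
    (hy₀ : ∀ i, y₀ i ∈ M.production i) (hz₀J : ∀ i (j : J), z₀ i (Sum.inr j) = 0)
    (hclear : ∀ c : C, ∑ i, z₀ i (Sum.inl c) = ∑ i, y₀ i (Sum.inl c)) :
    ∑ i, ∑ a, p a * z₀ i a ≤ ∑ c : C, p (Sum.inl c) * ∑ i, y i (Sum.inl c) +
      ∑ j : J, p (Sum.inr j) * ∑ b, min (z b (Sum.inr j)) (∑ k : S j ⊕ A, available y j k) := by
  refine le_trans ?_ (M.sum_profit_le hp hz fun i => M.production_nonneg i _ (hy i))
  have h1 : ∑ i, ∑ a, p a * z₀ i a = ∑ i, ∑ c : C, p (Sum.inl c) * y₀ i (Sum.inl c) := by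
    simp only [Fintype.sum_sum_type, hz₀J, mul_zero, Finset.sum_const_zero, add_zero]
    rw [Finset.sum_comm, Finset.sum_comm (s := Finset.univ (α := A))]
    refine Finset.sum_congr rfl fun c _ => ?_
    rw [← Finset.mul_sum, ← Finset.mul_sum, hclear c]
  rw [h1]
  exact Finset.sum_le_sum fun i _ =>
    (M.le_profit hp z y i (M.production_nonneg i _ (hy₀ i))).trans (hopt i _ (hy₀ i))

variable [Nonempty A]

/-- If consumption is worth no more than the earnings, then excess demand has value at most
zero. -/
theorem value_excess_nonpos (M : MixedMarket A C J S) {p : C ⊕ J → ℝ} (hp : 0 ≤ p)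
    {z y : A → C ⊕ J → ℝ} 
    (h : ∑ i, ∑ a, p a * z i a ≤ ∑ c : C, p (Sum.inl c) * ∑ i, y i (Sum.inl c) +
      ∑ j : J, p (Sum.inr j) * ∑ b, min (z b (Sum.inr j)) (∑ k : S j ⊕ A, available y j k)) :
    ∑ a, p a * M.excess z y a ≤ 0 := by
  have h1 : ∑ i, ∑ a, p a * z i a = ∑ c : C, p (Sum.inl c) * ∑ i, z i (Sum.inl c) +
      ∑ j : J, p (Sum.inr j) * ∑ i, z i (Sum.inr j) := by
    rw [Finset.sum_comm, Fintype.sum_sum_type]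
    simp only [Finset.mul_sum]
  have h2 : ∑ a, p a * M.excess z y a ≤ (∑ c : C, p (Sum.inl c) * ∑ i, z i (Sum.inl c) -
      ∑ c : C, p (Sum.inl c) * ∑ i, y i (Sum.inl c)) +
      (∑ j : J, p (Sum.inr j) * ∑ i, z i (Sum.inr j) -
      ∑ j : J, p (Sum.inr j) * ∑ b, min (z b (Sum.inr j)) (∑ k : S j ⊕ A, available y j k)) := by
    rw [Fintype.sum_sum_type, ← Finset.sum_sub_distrib, ← Finset.sum_sub_distrib]
    refine add_le_add (Finset.sum_le_sum fun c _ => ?_) (Finset.sum_le_sum fun j _ => ?_)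
    · rw [← mul_sub]
      rfl
    · rw [← mul_sub, ← Finset.sum_sub_distrib]
      refine mul_le_mul_of_nonneg_left ?_ (hp _)
      simp only [excess]
      rw [sub_le_iff_le_add]
      refine Finset.sup'_le _ _ fun i _ => ?_
      -- The overshoot of the largest demand is one term in the sum of all the buyers' overshoots.
      have h3 : z i (Sum.inr j) - min (z i (Sum.inr j)) (∑ k : S j ⊕ A, available y j k) ≤
          ∑ i, (z i (Sum.inr j) - min (z i (Sum.inr j)) (∑ k : S j ⊕ A, available y j k)) :=
        Finset.single_le_sum
          (f := fun i => z i (Sum.inr j) - min (z i (Sum.inr j)) (∑ k : S j ⊕ A, available y j k))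
          (fun i _ => sub_nonneg.2 (min_le_left _ _)) (Finset.mem_univ i)
      linarith [min_le_right (z i (Sum.inr j)) (∑ k : S j ⊕ A, available y j k)]
  linarith

theorem exists_isQuasiEquilibrium [Nonempty (C ⊕ J)] (M : MixedMarket A C J S) {u : A → ℝ}
    (hu : M.AttainedConventionally u) {i₀ : A} (hi₀ : 0 < u i₀) {K R : ℝ} (hK0 : 0 ≤ K)
    (hKR : K ≤ R) (hK : ∀ y : A → C ⊕ J → ℝ, (∀ i, y i ∈ M.production i) →
      (∀ c : C, ∑ i, y i (Sum.inl c) ≤ K) ∧ ∀ j : J, ∑ k : S j ⊕ A, available y j k ≤ K)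
    (hR : ∀ i, M.utility i (fun _ => K) < M.utility i fun _ => R) :
    ∃ p α z y, M.IsQuasiEquilibrium u R p α z y ∧ (∀ i, z i ≤ fun _ => K) ∧
      α * u i₀ ≤ M.utility i₀ (fun _ => K) := by
  classical
  obtain ⟨y₀, z₀, hy₀, -, hz₀, hz₀J, hclear, hu⟩ := hu
  have hR0 : 0 ≤ R := hK0.trans hKR
  have hRv : (0 : C ⊕ J → ℝ) ≤ fun _ => R := fun _ => hR0
  have hext : ∀ i, (M.utilityExt i fun _ => R) = M.utility i fun _ => R :=
    fun i => M.utilityExt_of_nonneg i hRv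
  -- At this scale agent `i₀` is promised the utility of the corner `R`, which is out of reach when
  -- excess demand is nonpositive.
  set αmax := M.utility i₀ (fun _ => R) / u i₀ with hαmax
  have hα0 : 0 ≤ αmax := div_nonneg (M.utility_nonneg i₀ _ hRv) hi₀.le
  have hPne : ∀ i, (M.production i).Nonempty := fun i => ⟨_, hy₀ i⟩
  have hpos : ∀ q ∈ M.feasibleStates αmax R, 0 ≤ q.1 := fun q hq => hq.1.1
  have hfn : (M.feasibleStates αmax R).Nonempty :=
    ⟨(Pi.single (Classical.arbitrary _) 1, 0, 0, y₀), single_mem_stdSimplex ℝ _, ⟨le_rfl, hα0⟩,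
      fun _ _ => ⟨le_rfl, hRv⟩, fun i _ => hy₀ i⟩
  have hfc : Convex ℝ (M.feasibleStates αmax R) :=
    (convex_stdSimplex ℝ _).prod ((convex_Icc _ _).prod
      ((convex_pi fun _ _ => convex_Icc _ _).prod (convex_pi fun i _ => M.production_convex i)))
  obtain ⟨⟨p, α, z, y⟩, hq, hfix⟩ := exists_mem_of_isClosed_graph
    (M.isCompact_feasibleStates αmax R) hfc hfn
    (fun q _ => M.reactions_subset u αmax R q)
    (fun q hq => M.reactions_nonempty u hα0 hR0 hPne (hpos q hq))
    (fun q hq => M.convex_reactions u αmax R (hpos q hq)) (M.isClosed_graph_reactions u αmax R)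
  obtain ⟨⟨hpΔ, hpmax⟩, ⟨hα, hαmin⟩, hzr, hyr⟩ := hfix
  simp only at hpΔ hpmax hα hαmin hzr hyr
  have hp : 0 ≤ p := hpΔ.1
  have hy : ∀ i, y i ∈ M.production i := fun i => (hyr i trivial).1
  have hopt : ∀ i, ∀ y' ∈ M.production i, M.profit p z y i y' ≤ M.profit p z y i (y i) :=
    fun i => (hyr i trivial).2
  have hz : 0 ≤ z := fun i => (hzr i trivial).1.1.1
  have hle : ∀ i, min (α * u i) (M.utility i fun _ => R) ≤ M.utility i (z i) := fun i => by
    have := (hzr i trivial).1.2.1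
    rwa [hext, M.utilityExt_of_nonneg i (hz i)] at this
  have hcheap : ∀ i, ∀ z' ∈ Set.Icc (0 : C ⊕ J → ℝ) (fun _ => R),
      min (α * u i) (M.utility i fun _ => R) < M.utilityExt i z' →
      ∑ a, p a * z i a ≤ ∑ a, p a * z' a := fun i => by
    have := (hzr i trivial).1.2.2
    rwa [hext] at this
  have hzero : ∀ i, u i = 0 → z i = 0 := fun i => (hzr i trivial).2
  set V := ∑ a, p a * M.excess z y a with hV
  -- Optimality of `p` is tested against putting all the price on `a`.
  have hEV : ∀ a, M.excess z y a ≤ V := by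
    intro a
    have := hpmax _ (single_mem_stdSimplex ℝ a)
    simpa [Pi.single_apply] using this
  have hz₀K : ∀ i, z₀ i ≤ fun _ => K := by
    rintro i (c | j)
    · have h1 : z₀ i (Sum.inl c) ≤ ∑ i, z₀ i (Sum.inl c) :=
        Finset.single_le_sum (f := fun i => z₀ i (Sum.inl c)) (fun i _ => hz₀ i _)
          (Finset.mem_univ i)
      rw [hclear c] at h1
      exact h1.trans ((hK y₀ hy₀).1 c)
    · rw [hz₀J]; exact hK0
  have hVle : V ≤ 0 := by
    by_contra! hVpos
    have hα' : α = 0 := by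
      have := hαmin 0 ⟨le_rfl, hα0⟩
      rw [zero_mul] at this
      exact le_antisymm (by nlinarith) hα.1
    refine absurd (M.value_excess_nonpos hp (le_trans ?_
      (M.value_conventional_le hp hz hy hopt hy₀ hz₀J hclear))) (not_le.2 hVpos)
    refine Finset.sum_le_sum fun i _ => ?_
    -- For `u i = 0` the bundle `z₀ i` need not be strictly better than `α * u i`, so the cost
    -- comparison relies on `z i = 0`, built into the reactions.
    by_cases hi : u i = 0
    · rw [hzero i hi]
      simp only [Pi.zero_apply, mul_zero, Finset.sum_const_zero]
      exact Finset.sum_nonneg fun a _ => mul_nonneg (hp a) (hz₀ i a)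
    · refine hcheap i (z₀ i) ⟨hz₀ i, (hz₀K i).trans fun _ => hKR⟩ ?_
      rw [M.utilityExt_of_nonneg i (hz₀ i), ← hu i, hα', zero_mul]
      exact (min_le_left _ _).trans_lt
        (lt_of_le_of_ne (by rw [hu i]; exact M.utility_nonneg i _ (hz₀ i)) (Ne.symm hi))
  have hzK : ∀ i, z i ≤ fun _ => K :=
    M.le_of_excess_nonpos hK hz hy fun a => (hEV a).trans hVle
  have hzKU : ∀ i, M.utility i (z i) < M.utility i fun _ => R := fun i =>
    (M.utility_mono i (hz i) (hzK i)).trans_lt (hR i)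
  -- The cap kept compensated demand nonempty; it is inactive here because `z i` lies below `K` and
  -- so has less utility than the corner `R`.
  have hmin : ∀ i, min (α * u i) (M.utility i fun _ => R) = α * u i := by
    intro i
    refine min_eq_left ?_
    by_contra! hlt
    have := hle i
    rw [min_eq_right hlt.le] at this
    exact absurd (hzKU i) (not_lt.2 this)
  simp only [hmin] at hle hcheap
  have hVeq : V = 0 := by
    refine le_antisymm hVle ?_
    by_contra! hVneg
    have h1 := hαmin αmax ⟨hα0, le_rfl⟩
    have h2 : αmax ≤ α := by nlinarith
    have h3 : M.utility i₀ (fun _ => R) ≤ α * u i₀ := (div_le_iff₀ hi₀).1 h2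
    exact absurd (hzKU i₀) (not_lt.2 (h3.trans (hle i₀)))
  refine ⟨p, α, z, y, ⟨hpΔ, hα.1, hy, hopt, fun a => (hEV a).trans hVle, hVeq, hz,
    fun i => ?_, hcheap, hzero⟩, hzK, (hle i₀).trans (M.utility_mono i₀ (hz i₀) (hzK i₀))⟩
  rw [M.utilityExt_of_nonneg i (hz i)]
  exact hle i

/-- The bound on the bundles to which the allocation is compared can be removed. -/
theorem exists_forall_isQuasiEquilibrium [Nonempty (C ⊕ J)] (M : MixedMarket A C J S) {u : A → ℝ}
    (hu : M.AttainedConventionally u) (hpos : ∃ i, 0 < u i) :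
    ∃ p α z y, ∀ R, M.IsQuasiEquilibrium u R p α z y := by
  obtain ⟨i₀, hi₀⟩ := hpos
  obtain ⟨K, hK0, hK⟩ := M.exists_production_bound
  obtain ⟨R₀, hR₀, hU⟩ := M.exists_larger_box K hK0
  set αmax := M.utility i₀ (fun _ => K) / u i₀
  have hmono : ∀ {R R' : ℝ} {p α z y}, R ≤ R' → M.IsQuasiEquilibrium u R' p α z y →
      M.IsQuasiEquilibrium u R p α z y := fun hRR h =>
    ⟨h.1, h.2, h.3, h.4, h.5, h.6, h.7, h.8, fun i z' hz' =>
      h.9 i z' ⟨hz'.1, hz'.2.trans fun _ => hRR⟩, h.10⟩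
  -- The bounds `K` and `αmax` do not depend on the box `R₀ + n`, so these are decreasing nonempty
  -- compact sets; a common point works for every box.
  let Q : ℕ → Set (State A C J) := fun n => M.feasibleStates αmax K ∩
    {q | M.IsQuasiEquilibrium u (R₀ + n) q.1 q.2.1 q.2.2.1 q.2.2.2}
  have hcl : ∀ n, IsClosed (Q n) := fun n =>
    (M.isCompact_feasibleStates αmax K).isClosed.inter (M.isClosed_setOf_isQuasiEquilibrium u _)
  obtain ⟨q, hq⟩ : (⋂ n, Q n).Nonempty := by
    refine IsCompact.nonempty_iInter_of_sequence_nonempty_isCompact_isClosed Q ?_ ?_ ?_ hcl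
    · exact fun n q hq => ⟨hq.1, hmono (by push_cast; linarith) hq.2⟩
    · intro n
      have hn : R₀ ≤ R₀ + n := le_add_of_nonneg_right (Nat.cast_nonneg n)
      obtain ⟨p, α, z, y, h, hzK, hα⟩ := M.exists_isQuasiEquilibrium hu hi₀ hK0 (hR₀.trans hn) hK
        fun i => (hU i).trans_le
          (M.utility_mono i (fun _ => hK0.trans hR₀) fun _ => hn)
      exact ⟨(p, α, z, y), ⟨h.price_mem, ⟨h.scale_nonneg, (le_div_iff₀ hi₀).2 hα⟩,
        fun i _ => ⟨h.allocation_nonneg i, hzK i⟩, fun i _ => h.production_mem i⟩, h⟩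
    · exact (M.isCompact_feasibleStates αmax K).of_isClosed_subset (hcl 0) fun q hq => hq.1
  refine ⟨q.1, q.2.1, q.2.2.1, q.2.2.2, fun R => ?_⟩
  obtain ⟨n, hn⟩ := exists_nat_ge (R - R₀)
  exact hmono (by linarith) (Set.mem_iInter.1 hq n).2

end Welfare

end MixedMarket

namespace MixedMarket

/-! ### From compensated equilibrium to equilibrium with transfers -/

section Equilibrium

variable {A C J : Type*} {S : J → Type*} [Fintype A] [Fintype C] [Fintype J]
  [∀ j, Fintype (S j)] [Nonempty A]

theorem IsQuasiEquilibrium.le_available {M : MixedMarket A C J S} {u : A → ℝ} {R α : ℝ}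
    {p : C ⊕ J → ℝ} {z y : A → C ⊕ J → ℝ} (h : M.IsQuasiEquilibrium u R p α z y) (i : A) (j : J) :
    z i (Sum.inr j) ≤ ∑ k : S j ⊕ A, available y j k :=
  (Finset.le_sup' (fun i => z i (Sum.inr j)) (Finset.mem_univ i)).trans
    (sub_nonpos.1 (h.excess_nonpos (Sum.inr j)))

theorem IsQuasiEquilibrium.excess_eq_zero {M : MixedMarket A C J S} {u : A → ℝ} {R α : ℝ}
    {p : C ⊕ J → ℝ} {z y : A → C ⊕ J → ℝ} (h : M.IsQuasiEquilibrium u R p α z y) {a : C ⊕ J}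
    (ha : 0 < p a) : M.excess z y a = 0 := by
  have h1 := (Finset.sum_eq_zero_iff_of_nonpos fun a _ =>
    mul_nonpos_of_nonneg_of_nonpos (h.price_mem.1 a) (h.excess_nonpos a)).1 h.value_excess a
    (Finset.mem_univ a)
  exact (mul_eq_zero.1 h1).resolve_left ha.ne'

theorem IsQuasiEquilibrium.exists_eq_available {M : MixedMarket A C J S} {u : A → ℝ} {R α : ℝ}
    {p : C ⊕ J → ℝ} {z y : A → C ⊕ J → ℝ} (h : M.IsQuasiEquilibrium u R p α z y) {j : J}
    (hj : 0 < p (Sum.inr j)) : ∃ i, z i (Sum.inr j) = ∑ k : S j ⊕ A, available y j k := by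
  obtain ⟨i, -, hi⟩ := Finset.exists_mem_eq_sup' Finset.univ_nonempty fun i => z i (Sum.inr j)
  exact ⟨i, hi.symm.trans (sub_eq_zero.1 (h.excess_eq_zero hj))⟩

theorem IsQuasiEquilibrium.sum_value {M : MixedMarket A C J S} {u : A → ℝ} {R α : ℝ}
    {p : C ⊕ J → ℝ} {z y : A → C ⊕ J → ℝ} (h : M.IsQuasiEquilibrium u R p α z y) :
    ∑ i, ∑ a, p a * z i a = ∑ c : C, p (Sum.inl c) * ∑ i, y i (Sum.inl c) +
      ∑ j : J, p (Sum.inr j) * ∑ b, z b (Sum.inr j) := by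
  rw [Finset.sum_comm, Fintype.sum_sum_type]
  simp only [← Finset.mul_sum]
  congr 1
  refine Finset.sum_congr rfl fun c _ => ?_
  rcases (h.price_mem.1 (Sum.inl c)).eq_or_lt with hc | hc
  · rw [← hc, zero_mul, zero_mul]
  · rw [sub_eq_zero.1 (h.excess_eq_zero hc)]

/-- Some price is positive. If it is that of a conventional good, a producer of that good can make a
positive profit, which the buyers pay for. If it is that of a digital category, someone buys the
whole category, which contains an initial song. -/
theorem IsQuasiEquilibrium.sum_value_pos [∀ j, Nonempty (S j)] {M : MixedMarket A C J S}
    {u : A → ℝ} {R α : ℝ} {p : C ⊕ J → ℝ} {z y : A → C ⊕ J → ℝ}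
    (h : M.IsQuasiEquilibrium u R p α z y) : 0 < ∑ i, ∑ a, p a * z i a := by
  have hp : 0 ≤ p := h.price_mem.1
  have hy : 0 ≤ y := fun i => M.production_nonneg i _ (h.production_mem i)
  obtain ⟨a, ha⟩ : ∃ a, 0 < p a := by
    by_contra! hcon
    have h1 := Finset.sum_nonpos (s := Finset.univ) fun a _ => hcon a
    rw [h.price_mem.2] at h1
    exact absurd h1 (by norm_num)
  rcases a with c | j
  · obtain ⟨i, y', hy', hpos⟩ := M.producible c
    have h1 := M.sum_profit_le hp h.allocation_nonneg hy
    simp only [min_eq_left (h.le_available _ _)] at h1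
    rw [← h.sum_value] at h1
    refine lt_of_lt_of_le ?_ h1
    have hnn : ∀ k, 0 ≤ M.profit p z y k (y k) := fun k =>
      le_trans (Finset.sum_nonneg fun c _ => mul_nonneg (hp (Sum.inl c)) (hy k (Sum.inl c)))
        (M.le_profit hp z y k (hy k))
    refine Finset.sum_pos' (fun k _ => hnn k) ⟨i, Finset.mem_univ i, ?_⟩
    refine lt_of_lt_of_le ?_ (h.production_optimal i y' hy')
    refine lt_of_lt_of_le ?_ (M.le_profit hp z y i (M.production_nonneg i y' hy'))
    exact Finset.sum_pos' (fun c _ => mul_nonneg (hp _) (M.production_nonneg i y' hy' _))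
      ⟨c, Finset.mem_univ c, mul_pos ha hpos⟩
  · obtain ⟨i, hi⟩ := h.exists_eq_available ha
    refine Finset.sum_pos' (fun k _ => Finset.sum_nonneg fun a _ =>
      mul_nonneg (hp a) (h.allocation_nonneg k a)) ⟨i, Finset.mem_univ i, ?_⟩
    refine Finset.sum_pos' (fun a _ => mul_nonneg (hp a) (h.allocation_nonneg i a))
      ⟨Sum.inr j, Finset.mem_univ _, mul_pos ha ?_⟩
    rw [hi]
    exact Finset.sum_pos' (fun k _ => available_nonneg hy j k)
      ⟨Sum.inl (Classical.arbitrary (S j)), Finset.mem_univ _, zero_lt_one⟩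

theorem isEquilibriumWithTransfers_of_quasi [∀ j, Nonempty (S j)] {M : MixedMarket A C J S}
    {u : A → ℝ} {α : ℝ} {p : C ⊕ J → ℝ} {z y : A → C ⊕ J → ℝ}
    (h : ∀ R, M.IsQuasiEquilibrium u R p α z y) (hu : M.AttainedConventionally u) :
    1 ≤ α ∧ M.IsEquilibriumWithTransfers (fun i => ∑ a, p a * z i a) p z
      (fun b j k => M.detailed y b j (z b (Sum.inr j)) k) y ∧
      ∀ i, M.utility i (z i) = α * u i := by
  classical
  obtain ⟨y₀, z₀, hy₀, -, hz₀, hz₀J, hclear, hu⟩ := hu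
  -- Any box will do here, as only the clause `cheapest` depends on it.
  have hq := h 0
  have hp : 0 ≤ p := hq.price_mem.1
  have hz : ∀ i, 0 ≤ z i := hq.allocation_nonneg
  have hy : 0 ≤ y := fun i => M.production_nonneg i _ (hq.production_mem i)
  have hu0 : ∀ i, 0 ≤ u i := fun i => hu i ▸ M.utility_nonneg i _ (hz₀ i)
  have hvalue : ∀ {x : C ⊕ J → ℝ}, 0 ≤ x → 0 ≤ ∑ a, p a * x a :=
    fun hx => Finset.sum_nonneg fun a _ => mul_nonneg (hp a) (hx a)
  have hle : ∀ i, α * u i ≤ M.utility i (z i) := fun i => by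
    rw [← M.utilityExt_of_nonneg i (hz i)]
    exact hq.le_utility i
  have hcheap : ∀ i z', 0 ≤ z' → α * u i < M.utility i z' →
      ∑ a, p a * z i a ≤ ∑ a, p a * z' a := by
    intro i z' hz' hlt
    rw [← M.utilityExt_of_nonneg i hz'] at hlt
    -- The sum of the coordinates bounds each of them, so this box contains `z'`.
    exact (h (∑ a, z' a)).cheapest i z' ⟨hz', fun a =>
      Finset.single_le_sum (fun a _ => hz' a) (Finset.mem_univ a)⟩ hlt
  have hstrict : ∀ i z', 0 ≤ z' → α * u i < M.utility i z' → 0 < ∑ a, p a * z' a →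
      ∑ a, p a * z i a < ∑ a, p a * z' a := by
    intro i z' hz' hlt hpos
    obtain ⟨z'', hz'', hlt', hc⟩ := M.exists_cheaper i hz' hlt hpos
    exact (hcheap i z'' hz'' hlt').trans_lt hc
  obtain ⟨i₁, hi₁⟩ : ∃ i, 0 < ∑ a, p a * z i a := by
    by_contra! hcon
    exact absurd (Finset.sum_nonpos fun i _ => hcon i) (not_le.2 hq.sum_value_pos)
  -- A free good would let agent `i₁`, whose budget is positive, improve at no extra cost,
  -- contradicting `hstrict`.
  have hppos : ∀ a, 0 < p a := by
    intro a
    refine lt_of_le_of_ne (hp a) fun h0 => ?_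
    obtain ⟨z', hoff, ha, hlt⟩ := M.utility_nonsatiated i₁ (z i₁) (hz i₁) a
    have hz' : 0 ≤ z' := by
      intro b
      by_cases hb : b = a
      · exact hb ▸ (hz i₁ a).trans ha.le
      · rw [hoff b hb]; exact hz i₁ b
    have he : ∑ b, p b * z' b = ∑ b, p b * z i₁ b := by
      refine Finset.sum_congr rfl fun b _ => ?_
      by_cases hb : b = a
      · rw [hb, ← h0]; simp
      · rw [hoff b hb]
    have h1 := hstrict i₁ z' hz' ((hle i₁).trans_lt hlt) (he ▸ hi₁)
    rw [he] at h1
    exact lt_irrefl _ h1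
  have hzero : ∀ {x : C ⊕ J → ℝ}, 0 ≤ x → ∑ a, p a * x a ≤ 0 → x = 0 := by
    intro x hx hle
    have h1 := (Finset.sum_eq_zero_iff_of_nonneg fun a _ => mul_nonneg (hp a) (hx a)).1
      (le_antisymm hle (hvalue hx))
    exact funext fun a => (mul_eq_zero.1 (h1 a (Finset.mem_univ a))).resolve_left (hppos a).ne'
  have hα : 1 ≤ α := by
    by_contra! hα
    have hbetter : ∀ i, u i ≠ 0 → α * u i < M.utility i (z₀ i) := fun i hi => by
      rw [← hu i]
      exact mul_lt_of_lt_one_left (lt_of_le_of_ne (hu0 i) (Ne.symm hi)) hα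
    -- For `α < 1` the conventional bundles strictly beat the targets `α * u i` of all agents with
    -- `u i ≠ 0`, so they cost at least as much, and strictly more for `i₁`; yet optimal earnings
    -- cover their total cost.
    have h1 : ∑ i, ∑ a, p a * z i a < ∑ i, ∑ a, p a * z₀ i a := by
      refine Finset.sum_lt_sum (fun i _ => ?_) ⟨i₁, Finset.mem_univ _, ?_⟩
      · by_cases hi : u i = 0
        · rw [hq.eq_zero i hi]
          simpa using hvalue (hz₀ i)
        · exact hcheap i _ (hz₀ i) (hbetter i hi)
      · have hi : u i₁ ≠ 0 := by
          intro hi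
          rw [hq.eq_zero i₁ hi] at hi₁
          simp at hi₁
        have h2 := hcheap i₁ _ (hz₀ i₁) (hbetter i₁ hi)
        exact hstrict i₁ _ (hz₀ i₁) (hbetter i₁ hi) (hi₁.trans_le h2)
    have h2 := M.value_conventional_le hp hz hq.production_mem hq.production_optimal hy₀ hz₀J hclear
    simp only [min_eq_left (hq.le_available _ _)] at h2
    rw [← hq.sum_value] at h2
    linarith
  have hutil : ∀ i, M.utility i (z i) = α * u i := by
    intro i
    refine le_antisymm ?_ (hle i)
    by_contra! hlt
    by_cases hi : 0 < ∑ a, p a * z i a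
    · exact lt_irrefl _ (hstrict i _ (hz i) hlt hi)
    · have h1 : M.utility i (z i) ≤ u i := by
        rw [hzero (hz i) (not_lt.1 hi), hu i]
        exact M.utility_mono i le_rfl (hz₀ i)
      nlinarith [hu0 i]
  refine ⟨hα, ⟨hp, fun i => hvalue (hz i), ?_, hq.production_mem, fun i y' hy' => ?_, hz,
    fun i => rfl, fun i z' hz' hb => ?_, fun i j k => rfl, fun c => ?_, fun j hj k => ?_,
    hq.le_available⟩, hutil⟩
  · rw [M.sum_earnings p hz hy hq.le_available, hq.sum_value]
  · rw [M.earnings_eq p hz hy hq.le_available, M.earnings_eq p hz hy hq.le_available]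
    exact add_le_add_left (hq.production_optimal i y' hy') _
  · by_contra! hlt
    by_cases hpos : 0 < ∑ a, p a * z' a
    · exact absurd (hstrict i z' hz' ((hle i).trans_lt hlt) hpos) (not_lt.2 hb)
    · rw [hzero hz' (not_lt.1 hpos)] at hlt
      exact absurd (M.utility_mono i le_rfl (hz i)) (not_le.2 hlt)
  · exact sub_eq_zero.1 (hq.excess_eq_zero (hppos (Sum.inl c)))
  · obtain ⟨i, hi⟩ := hq.exists_eq_available hj
    exact ⟨i, M.detailed_of_total_le hy i j hi.ge k⟩

end Equilibrium

end MixedMarket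

theorem mainTheorem3 {A C J : Type*} {S : J → Type*} [Fintype A] [Fintype C] [Nonempty C]
    [Fintype J] [∀ j, Fintype (S j)] [∀ j, Nonempty (S j)]
    (M : MixedMarket A C J S) (u : A → ℝ)
    (hu : M.AttainedConventionally u) (hpos : ∃ i, 0 < u i) :
    ∃ (w : A → ℝ) (α : ℝ), 1 ≤ α ∧
      ∃ (p : C ⊕ J → ℝ) (z : A → C ⊕ J → ℝ) (x : A → ∀ j : J, S j ⊕ A → ℝ)
        (y : A → C ⊕ J → ℝ),
        M.IsEquilibriumWithTransfers w p z x y ∧ ∀ i, M.utility i (z i) = α * u i := by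
  have : Nonempty A := ⟨hpos.choose⟩
  obtain ⟨p, α, z, y, h⟩ := M.exists_forall_isQuasiEquilibrium hu hpos
  obtain ⟨hα, heq, hutil⟩ := MixedMarket.isEquilibriumWithTransfers_of_quasi h hu
  exact ⟨_, α, hα, p, z, _, y, heq, hutil⟩
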